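/- Fix $\mu\in(0,1]$ and $\alpha>2$. For each $N$ let $A_N=[a_{ij}]_{i,j=1}^N$ (with $a_{ij}=a_{ij}(N)$) be a real symmetric or complex Hermitian random matrix, let $B(N)$ be the set of pairs $(i,j)$ such that $a_{ij}$ is not almost surely zero, and suppose the following. (i) There is a sequence $a_N\to1$ such that for all $i\in\{1,\dots,N\}$ the number of $j$ with $(i,j)\in B(N)$ is at most $a_NN^\mu$, with equality for all $i$ but $o(N)$ of them. (ii) The entries $a_{ij}$ with $(i,j)\in B(N)$ are i.i.d. up to the symmetry of the matrix (in the complex case the diagonal entries, which are real, are independent of the others, i.i.d., and only required to satisfy the same tail condition), and $\mathbb P(|a_{ij}|\ge x)=L(x)x^{-\alpha}$ for all $x>0$, for a slowly varying function $L$ not depending on $N$. (iii) The entries $a_{ij}$ with $(i,j)\in B(N)$ are symmetrically distributed ($a_{ij}$ and $-a_{ij}$ have the same law) and have variance one. (Slowly varying means: measurable, eventually positive, and $L(tx)/L(x)\to1$ as $x\to+\infty$ for every $t>0$.) Let $\gamma,\gamma',\gamma''>0$ satisfy $$\frac{\mu}{2}\le\gamma'\qquad\text{and}\qquad\frac{\mu}{4}+\gamma+\gamma''<\gamma',$$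 and, if $\gamma'=\mu/2$, suppose moreover that $\sup_N (a_N-1)N^{\gamma''}<\infty$ (which holds for instance if $a_N\le1$ for all $N$). Let $\hat A_N=[a_{ij}\mathbf 1_{|a_{ij}|\le N^\gamma}]_{i,j=1}^N$. Then there is a slowly varying function $L_0$ such that for all $N$ and all integers $s$ with $1\le s\le N^{\gamma''}$, $$\mathbb E\big[\operatorname{Tr}(\hat A_N^{2s})\big]\le L_0(N)\,N^{1+2\gamma}\,s^{-3/2}\,(2N^{\gamma'})^{2s},$$ and, for every $\kappa>0$ (possibly depending on $N$), with $\|\cdot\|$ the $\ell^2\to\ell^2$ operator norm, $$\mathbb P\big(\|\hat A_N\|\ge\kappa\cdot2N^{\gamma'}\big)\le\kappa^{-2s}L_0(N)\,N^{1+2\gamma}\,s^{-3/2}.$$ -/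

import Mathlib

open MeasureTheory ProbabilityTheory Filter Topology Asymptotics

/-- A slowly varying function (at `+∞`): measurable, eventually positive, and
`L (t x) / L x → 1` as `x → ∞` for every fixed `t > 0`. -/
def SlowlyVarying (L : ℝ → ℝ) : Prop :=
  Measurable L ∧ (∀ᶠ x in atTop, 0 < L x) ∧
    ∀ t : ℝ, 0 < t → Tendsto (fun x => L (t * x) / L x) atTop (𝓝 1)

section Matrices

variable {𝕜 : Type*} [RCLike 𝕜] {N : ℕ}

/-- The set `B(N)` of the positions `(i, j)` of the entries that are not almost surely zero. -/
def nonzeroEntries {Ω : Type*} [MeasurableSpace Ω] (P : Measure Ω)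
    (A : Ω → Matrix (Fin N) (Fin N) 𝕜) : Set (Fin N × Fin N) :=
  {p | ¬ ∀ᵐ ω ∂P, A ω p.1 p.2 = 0}

/-- The number of `j` such that the entry `(i, j)` is not almost surely zero. -/
noncomputable def rowCount {Ω : Type*} [MeasurableSpace Ω] (P : Measure Ω)
    (A : Ω → Matrix (Fin N) (Fin N) 𝕜) (i : Fin N) : ℕ :=
  Set.ncard {j : Fin N | (i, j) ∈ nonzeroEntries P A}

/-- The matrix in which the entries of modulus larger than `K` are replaced by `0`. -/
noncomputable def truncateEntries (K : ℝ) (M : Matrix (Fin N) (Fin N) 𝕜) :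
    Matrix (Fin N) (Fin N) 𝕜 :=
  Matrix.of fun i j => if ‖M i j‖ ≤ K then M i j else 0

/-- The `ℓ² → ℓ²` operator norm of a square matrix. -/
noncomputable def l2OpNorm (M : Matrix (Fin N) (Fin N) 𝕜) : ℝ :=
  ‖Matrix.toEuclideanCLM (n := Fin N) (𝕜 := 𝕜) M‖

end Matrices

/-- The standing assumptions on a sequence `A N` of `N × N` random matrices, real symmetric
(`𝕜 = ℝ`) or complex Hermitian (`𝕜 = ℂ`), with sparsity exponent `μ`, tail exponent `α`,
sequence `a N → 1` and slowly varying function `L`. -/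
structure IsSparseHeavyTailed {𝕜 : Type*} [RCLike 𝕜] {Ω : ℕ → Type*}
    [∀ N, MeasurableSpace (Ω N)] (P : ∀ N, Measure (Ω N))
    (A : ∀ N, Ω N → Matrix (Fin N) (Fin N) 𝕜)
    (μ α : ℝ) (a : ℕ → ℝ) (L : ℝ → ℝ) : Prop where
  measurable : ∀ N i j, Measurable fun ω => A N ω i j
  hermitian : ∀ N ω, (A N ω).IsHermitian
  /-- Every row has at most `a N * N ^ μ` entries that are not a.s. zero ... -/
  row_le : ∀ N i, (rowCount (P N) (A N) i : ℝ) / (N : ℝ) ^ μ ≤ a N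
  /-- ... with equality for all but `o(N)` of the rows, -/
  row_eq : (fun N => (Set.ncard
      {i : Fin N | (rowCount (P N) (A N) i : ℝ) / (N : ℝ) ^ μ ≠ a N} : ℝ))
        =o[atTop] (fun N : ℕ => (N : ℝ))
  /-- where `a N → 1`. -/
  tendsto_a : Tendsto a atTop (𝓝 1)
  /-- The entries on and above the diagonal are independent (entries outside `B(N)` are
  almost surely zero, so including them in the family changes nothing). -/
  indep : ∀ N, iIndepFun
    (fun (p : {p : Fin N × Fin N // p.1 ≤ p.2}) (ω : Ω N) => A N ω p.1.1 p.1.2) (P N)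
  /-- The entries of `B(N)` above the diagonal are identically distributed, -/
  ident_offDiag : ∀ N (i j k l : Fin N), i < j → k < l →
    (i, j) ∈ nonzeroEntries (P N) (A N) → (k, l) ∈ nonzeroEntries (P N) (A N) →
    IdentDistrib (fun ω => A N ω i j) (fun ω => A N ω k l) (P N) (P N)
  /-- and so are those on the diagonal. Diagonal entries of a complex Hermitian matrix are real,
  so they share with the other entries only the law of the modulus, given by `tail`. -/
  ident_diag : ∀ N (i k : Fin N),
    (i, i) ∈ nonzeroEntries (P N) (A N) → (k, k) ∈ nonzeroEntries (P N) (A N) →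
    IdentDistrib (fun ω => A N ω i i) (fun ω => A N ω k k) (P N) (P N)
  slowlyVarying : SlowlyVarying L
  /-- The tail of the entries of `B(N)`, the same for all `N`. -/
  tail : ∀ N (i j : Fin N), (i, j) ∈ nonzeroEntries (P N) (A N) → ∀ x : ℝ, 0 < x →
    (P N).real {ω | x ≤ ‖A N ω i j‖} = L x * x ^ (-α)

/-! Expand the trace over closed walks. Independence and symmetry of the law kill every walk that
crosses some undirected edge an odd number of times. With K = N^γ, unit variance bounds the
contribution of an edge crossed m ≥ 2 times by K^(m-2), so a surviving walk with e distinct edges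
weighs at most K^(2s-2e) (`norm_integral_walk_le`). These weights must be summed over the even
closed walks of a graph of degree at most d ≈ N^μ.

The sum is compared with the complete graph with loops on r vertices (`sum_evenClosed_le`). Group
walks by the pattern of coincidences between their vertices. A pattern with k new vertices after the
start has at most N d^k realisations in the sparse graph and at least r (r-k)^k in the complete one,
and k ≤ e ≤ s. Hence, if d ≤ K²(r-s), the weighted sum is at most (N/r) K^(2s) times the number of
even closed walks on r points.

That number is at most a trace moment of the Gaussian orthogonal ensemble of size r
(`evenClosedCount_le_goeMoment`): even moments of Gaussians of variance at least one are at least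
one, and the odd ones vanish. The trace moments obey loop equations (`goeMoment_cons_succ`), for
which an explicit supersolution (`goeWeight_rec`) yields the bound 3 r^(s+1) Cat(s) when 100 s^5 ≤
r² (`goeMoment_two_mul_le`). The estimate Cat(s) ≤ 4^s s^(-3/2) produces the power of s.

Finally r is chosen with K² r = N^(2γ') (1 + O(1/s)), which costs a constant after taking the s-th
power. Where s^5 may exceed r²/100, the hypotheses force γ' > μ + γ and the crude bound N (dK)^(2s)
suffices. A constant `L₀` works, and the norm bound is Markov's inequality. -/

/-! ### Gaussian expectation as a linear functional on polynomials -/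

section GaussianFunctional

/-- The `k`-th moment of a centred Gaussian variable of variance `c`. -/
noncomputable def gaussMoment (c : ℝ) : ℕ → ℝ
  | 0 => 1
  | 1 => 0
  | (k + 2) => c * (k + 1) * gaussMoment c k

theorem gaussMoment_nonneg {c : ℝ} (hc : 0 ≤ c) : ∀ k, 0 ≤ gaussMoment c k
  | 0 => by simp [gaussMoment]
  | 1 => by simp [gaussMoment]
  | (k + 2) => by
    have := gaussMoment_nonneg hc k
    simp only [gaussMoment]; positivity

theorem one_le_gaussMoment {c : ℝ} (hc : 1 ≤ c) : ∀ k, Even k → 1 ≤ gaussMoment c k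
  | 0, _ => by simp [gaussMoment]
  | 1, h => by simp at h
  | (k + 2), h => by
    have h1 := one_le_gaussMoment hc k (by simpa [Nat.even_add] using h)
    simp only [gaussMoment]
    have : (1 : ℝ) ≤ c * (k + 1) := by
      have : (0 : ℝ) ≤ k := Nat.cast_nonneg k
      nlinarith
    nlinarith

/-- At `k = 0` the factor `k` vanishes, so the truncated index `k - 1` is harmless. -/
theorem gaussMoment_succ (c : ℝ) (k : ℕ) :
    gaussMoment c (k + 1) = c * k * gaussMoment c (k - 1) := by
  cases k <;> simp [gaussMoment]

variable {σ : Type*} [Fintype σ]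

/-- The expectation of a polynomial in independent centred Gaussian variables with
variances `c`. -/
noncomputable def gaussExp (c : σ → ℝ) : MvPolynomial σ ℝ →ₗ[ℝ] ℝ :=
  (MvPolynomial.basisMonomials σ ℝ).constr ℝ fun m => ∏ e, gaussMoment (c e) (m e)

theorem gaussExp_monomial (c : σ → ℝ) (m : σ →₀ ℕ) (a : ℝ) :
    gaussExp c (MvPolynomial.monomial m a) = a * ∏ e, gaussMoment (c e) (m e) := by
  have h : MvPolynomial.monomial m a = a • MvPolynomial.basisMonomials σ ℝ m := by
    simp [MvPolynomial.smul_monomial]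
  rw [h, map_smul, gaussExp, Module.Basis.constr_basis, smul_eq_mul]

theorem gaussExp_one (c : σ → ℝ) : gaussExp c 1 = 1 := by
  have := gaussExp_monomial c 0 1
  simpa [gaussMoment] using this

/-- Gaussian integration by parts; on monomials it is the recursion of the moments. -/
theorem gaussExp_X_mul [DecidableEq σ] (c : σ → ℝ) (e : σ) (f : MvPolynomial σ ℝ) :
    gaussExp c (MvPolynomial.X e * f) = c e * gaussExp c (MvPolynomial.pderiv e f) := by
  induction f using MvPolynomial.induction_on' with
  | monomial m a =>
    rw [MvPolynomial.X, MvPolynomial.monomial_mul, one_mul, MvPolynomial.pderiv_monomial,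
      gaussExp_monomial, gaussExp_monomial,
      ← Finset.mul_prod_erase Finset.univ (fun i => gaussMoment (c i) ((Finsupp.single e 1 + m : σ →₀ ℕ) i))
        (Finset.mem_univ e),
      ← Finset.mul_prod_erase Finset.univ
        (fun i => gaussMoment (c i) (((m - Finsupp.single e 1 : σ →₀ ℕ)) i)) (Finset.mem_univ e)]
    have h : ∏ x ∈ Finset.univ.erase e, gaussMoment (c x) ((Finsupp.single e 1 + m : σ →₀ ℕ) x)
        = ∏ x ∈ Finset.univ.erase e, gaussMoment (c x) ((m - Finsupp.single e 1 : σ →₀ ℕ) x) := by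
      refine Finset.prod_congr rfl fun x hx => ?_
      have : e ≠ x := (Finset.ne_of_mem_erase hx).symm
      simp [this]
    rw [h]
    simp only [Finsupp.coe_add, Pi.add_apply, Finsupp.single_eq_same, Finsupp.coe_tsub,
      Pi.sub_apply]
    rw [add_comm 1, gaussMoment_succ]
    ring
  | add p q hp hq => rw [mul_add, map_add, map_add, map_add, hp, hq]; ring

theorem gaussExp_monomial_nonneg {c : σ → ℝ} (hc : ∀ e, 0 ≤ c e) (m : σ →₀ ℕ) :
    0 ≤ gaussExp c (MvPolynomial.monomial m 1) := by
  rw [gaussExp_monomial, one_mul]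
  exact Finset.prod_nonneg fun e _ => gaussMoment_nonneg (hc e) _

theorem one_le_gaussExp_monomial {c : σ → ℝ} (hc : ∀ e, 1 ≤ c e) (m : σ →₀ ℕ)
    (hm : ∀ e, Even (m e)) : 1 ≤ gaussExp c (MvPolynomial.monomial m 1) := by
  rw [gaussExp_monomial, one_mul]
  have : ∏ _e : σ, (1 : ℝ) ≤ ∏ e, gaussMoment (c e) (m e) :=
    Finset.prod_le_prod (fun _ _ => zero_le_one) fun e _ => one_le_gaussMoment (hc e) _ (hm e)
  simpa using this

end GaussianFunctional

theorem Derivation.multiset_prod {R A ι : Type*} [CommRing R] [CommRing A] [Algebra R A]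
    [DecidableEq ι] (D : Derivation R A A) (f : ι → A) (s : Multiset ι) :
    D (s.map f).prod = (s.map fun i => ((s.erase i).map f).prod * D (f i)).sum := by
  induction s using Multiset.induction_on with
  | empty => simp
  | cons i s ih =>
    rw [Multiset.map_cons, Multiset.prod_cons, D.leibniz, Multiset.map_cons, Multiset.sum_cons,
      Multiset.erase_cons_head, ih, smul_eq_mul, smul_eq_mul, add_comm]
    congr 1
    rw [← Multiset.sum_map_mul_left]
    refine congrArg Multiset.sum (Multiset.map_congr rfl fun j hj => ?_)
    by_cases hij : i = j
    · subst hij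
      rw [Multiset.erase_cons_head, ← mul_assoc, ← Multiset.prod_cons, ← Multiset.map_cons,
        Multiset.cons_erase hj]
    · rw [Multiset.erase_cons_tail _ (by simpa using hij), Multiset.map_cons,
        Multiset.prod_cons, mul_assoc]

/-! ### Loop equations of the Gaussian orthogonal ensemble -/

section GOE

variable {V : Type*} [Fintype V] [DecidableEq V]

/-- The generic symmetric matrix. -/
noncomputable def genSymm (V : Type*) : Matrix V V (MvPolynomial (Sym2 V) ℝ) :=
  Matrix.of fun x y => MvPolynomial.X s(x, y)

/-- The variances of the entries of the Gaussian orthogonal ensemble. -/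
noncomputable def goeVar (e : Sym2 V) : ℝ := if e.IsDiag then 2 else 1

/-- The derivation appearing in integration by parts with respect to the entry `(x, y)`. -/
noncomputable def goeDer (x y : V) :
    Derivation ℝ (MvPolynomial (Sym2 V) ℝ) (MvPolynomial (Sym2 V) ℝ) :=
  goeVar s(x, y) • MvPolynomial.pderiv s(x, y)

/-- The doubled variance on the diagonal is what keeps both terms when `x = y`, so that one formula
covers all entries. -/
theorem goeDer_genSymm {V : Type*} [DecidableEq V] (x y z w : V) : goeDer x y (genSymm V z w) =
    (if z = x ∧ y = w then 1 else 0) + (if z = y ∧ x = w then 1 else 0) := by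
  simp only [goeDer, genSymm, goeVar, Matrix.of_apply, Derivation.smul_apply,
    MvPolynomial.pderiv_X, Pi.single_apply, Sym2.eq_iff, Sym2.mk_isDiag_iff]
  by_cases hxy : x = y
  · subst hxy
    by_cases h1 : z = x
    · by_cases h2 : x = w
      · subst h1 h2; simp [two_smul]
      · have h3 : ¬ w = x := fun h => h2 h.symm
        simp [h1, h2, h3]
    · simp [h1]
  · simp only [hxy, if_false, one_smul]
    by_cases h1 : z = x <;> by_cases h2 : w = y <;> by_cases h3 : z = y <;> by_cases h4 : w = x <;>
      simp_all [eq_comm]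

theorem gaussExp_genSymm_mul (x y : V) (f : MvPolynomial (Sym2 V) ℝ) :
    gaussExp goeVar (genSymm V x y * f) = gaussExp goeVar (goeDer x y f) := by
  simp [genSymm, goeDer, gaussExp_X_mul]

theorem goeDer_pow (x y z w : V) (n : ℕ) : goeDer x y ((genSymm V ^ n) z w) =
    ∑ i ∈ Finset.range n, ((genSymm V ^ i) z x * (genSymm V ^ (n - 1 - i)) y w
      + (genSymm V ^ i) z y * (genSymm V ^ (n - 1 - i)) x w) := by
  induction n generalizing z with
  | zero => by_cases h : z = w <;> simp [Matrix.one_apply, h]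
  | succ n ih =>
    rw [pow_succ', Matrix.mul_apply, map_sum, Finset.sum_range_succ']
    simp only [Derivation.leibniz, smul_eq_mul, ih, goeDer_genSymm, Finset.sum_add_distrib]
    congr 1
    · have key : ∀ x y : V, ∑ v, genSymm V z v * ∑ i ∈ Finset.range n,
          (genSymm V ^ i) v x * (genSymm V ^ (n - 1 - i)) y w =
          ∑ i ∈ Finset.range n,
            (genSymm V ^ (i + 1)) z x * (genSymm V ^ (n + 1 - 1 - (i + 1))) y w := by
        intro x y
        simp only [Finset.mul_sum]
        rw [Finset.sum_comm]
        refine Finset.sum_congr rfl fun i _ => ?_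
        have : n + 1 - 1 - (i + 1) = n - 1 - i := by omega
        rw [pow_succ', Matrix.mul_apply, Finset.sum_mul, this]
        simp only [mul_assoc]
      simp only [mul_add, Finset.sum_add_distrib, key]
    · have key : ∀ x y : V, ∑ v, (genSymm V ^ n) v w * (if z = x ∧ y = v then 1 else 0) =
          (genSymm V ^ 0) z x * (genSymm V ^ (n + 1 - 1 - 0)) y w := by
        intro x y
        by_cases h1 : z = x <;> simp [h1]
      simp only [mul_add, Finset.sum_add_distrib, key]

theorem genSymm_pow_symm (n : ℕ) (x y : V) : (genSymm V ^ n) x y = (genSymm V ^ n) y x := by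
  have h : (genSymm V).transpose = genSymm V := by
    ext1 x y; simp [genSymm, Sym2.eq_swap]
  conv_lhs => rw [← h, ← Matrix.transpose_pow, Matrix.transpose_apply]

/-- Differentiating the `i`-th factor cuts the closed word. One orientation of the pair leaves two
traces; the other, by symmetry of the powers, reglues the pieces into the trace of the power `n -
1`, whatever `i` is. -/
theorem sum_goeDer_pow (n : ℕ) : ∑ x : V, ∑ y : V, goeDer x y ((genSymm V ^ n) y x) =
    ∑ i ∈ Finset.range n, (genSymm V ^ i).trace * (genSymm V ^ (n - 1 - i)).trace
      + n • (genSymm V ^ (n - 1)).trace := by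
  simp only [goeDer_pow]
  rw [Finset.sum_congr rfl fun x _ => Finset.sum_comm, Finset.sum_comm]
  have h : ∀ i ∈ Finset.range n, ∑ x : V, ∑ y : V,
      ((genSymm V ^ i) y x * (genSymm V ^ (n - 1 - i)) y x
        + (genSymm V ^ i) y y * (genSymm V ^ (n - 1 - i)) x x) =
      (genSymm V ^ i).trace * (genSymm V ^ (n - 1 - i)).trace + (genSymm V ^ (n - 1)).trace := by
    intro i hi
    have hi' : n - 1 = i + (n - 1 - i) := by have := Finset.mem_range.1 hi; omega
    simp only [Finset.sum_add_distrib]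
    rw [add_comm]
    congr 1
    · rw [Matrix.trace, Matrix.trace, Finset.sum_mul_sum, Finset.sum_comm]; rfl
    · conv_rhs => rw [hi', pow_add]
      simp only [Matrix.trace, Matrix.diag, Matrix.mul_apply]
      refine Finset.sum_congr rfl fun x _ => Finset.sum_congr rfl fun y _ => ?_
      rw [genSymm_pow_symm i y x]
  rw [Finset.sum_congr rfl h, Finset.sum_add_distrib]
  simp

theorem goeDer_trace_pow (x y : V) (n : ℕ) :
    goeDer x y (genSymm V ^ n).trace = (2 * n) • (genSymm V ^ (n - 1)) x y := by
  rw [Matrix.trace, map_sum]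
  simp only [Matrix.diag, goeDer_pow]
  rw [Finset.sum_comm]
  have h : ∀ i ∈ Finset.range n, ∑ z : V,
      ((genSymm V ^ i) z x * (genSymm V ^ (n - 1 - i)) y z
        + (genSymm V ^ i) z y * (genSymm V ^ (n - 1 - i)) x z) =
      2 • (genSymm V ^ (n - 1)) x y := by
    intro i hi
    have hi' : n - 1 = (n - 1 - i) + i := by have := Finset.mem_range.1 hi; omega
    rw [two_smul]
    conv_rhs => rw [hi', pow_add]
    rw [Finset.sum_add_distrib]
    congr 1
    · conv_rhs => rw [← pow_add, genSymm_pow_symm, pow_add, Matrix.mul_apply]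
      simp only [mul_comm]
    · rw [Matrix.mul_apply]; simp only [mul_comm]
  rw [Finset.sum_congr rfl h, Finset.sum_const, Finset.card_range, ← mul_smul, mul_comm]

/-- The product of the traces of the powers `l ∈ S` of the generic symmetric matrix. -/
noncomputable def traceProd (V : Type*) [Fintype V] [DecidableEq V] (S : Multiset ℕ) :
    MvPolynomial (Sym2 V) ℝ :=
  (S.map fun l => (genSymm V ^ l).trace).prod

theorem traceProd_cons (l : ℕ) (S : Multiset ℕ) :
    traceProd V (l ::ₘ S) = (genSymm V ^ l).trace * traceProd V S := by
  simp [traceProd]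

/-- Mixed trace moments of the Gaussian orthogonal ensemble. -/
noncomputable def goeMoment (V : Type*) [Fintype V] [DecidableEq V] (S : Multiset ℕ) : ℝ :=
  gaussExp goeVar (traceProd V S)

theorem goeMoment_zero : goeMoment V 0 = 1 := by simp [goeMoment, traceProd, gaussExp_one]

theorem goeMoment_cons_zero (S : Multiset ℕ) :
    goeMoment V (0 ::ₘ S) = Fintype.card V * goeMoment V S := by
  have : ((Fintype.card V : ℕ) : MvPolynomial (Sym2 V) ℝ) * traceProd V S
      = (Fintype.card V : ℝ) • traceProd V S := by
    rw [← nsmul_eq_mul, Nat.cast_smul_eq_nsmul]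
  rw [goeMoment, traceProd_cons, pow_zero, Matrix.trace_one, this, map_smul, smul_eq_mul,
    goeMoment]

theorem sum_mul_multiset_sum {V : Type*} [Fintype V] {R : Type*} [CommRing R] (a : V → V → R) (S : Multiset ℕ)
    (g : ℕ → R) (k : ℕ → ℕ) (h : ℕ → V → V → R) :
    ∑ x, ∑ y, a x y * (S.map fun l => g l * (k l • h l x y)).sum =
      (S.map fun l => (k l • ∑ x, ∑ y, a x y * h l x y) * g l).sum := by
  induction S using Multiset.induction_on with
  | empty => simp
  | cons i S ih =>
    simp only [Multiset.map_cons, Multiset.sum_cons, mul_add, Finset.sum_add_distrib, ih]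
    congr 1
    simp only [nsmul_eq_mul, Finset.mul_sum, Finset.sum_mul]
    refine Finset.sum_congr rfl fun _ _ => Finset.sum_congr rfl fun _ _ => ?_
    ring

/-- Integrate by parts one factor of the first trace. The derivative hits either the same trace,
which splits or is reglued, or another trace `l`, which merges with it. Truncated subtractions at `n
= 0` or `l = 0` come with zero coefficients. -/
theorem goeMoment_cons_succ (n : ℕ) (S : Multiset ℕ) :
    goeMoment V ((n + 1) ::ₘ S) =
      ∑ i ∈ Finset.range n, goeMoment V (i ::ₘ (n - 1 - i) ::ₘ S)
      + n * goeMoment V ((n - 1) ::ₘ S)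
      + (S.map fun l => 2 * l * goeMoment V ((n + (l - 1)) ::ₘ S.erase l)).sum := by
  have h1 : traceProd V ((n + 1) ::ₘ S) =
      ∑ x : V, ∑ y : V, genSymm V x y * ((genSymm V ^ n) y x * traceProd V S) := by
    rw [traceProd_cons, pow_succ', Matrix.trace]
    simp only [Matrix.diag, Matrix.mul_apply, Finset.sum_mul, mul_assoc]
  have h2 : ∑ x : V, ∑ y : V, goeDer x y ((genSymm V ^ n) y x * traceProd V S) =
      (∑ x : V, ∑ y : V, goeDer x y ((genSymm V ^ n) y x)) * traceProd V S
      + (S.map fun l => (2 * l) • traceProd V ((n + (l - 1)) ::ₘ S.erase l)).sum := by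
    simp only [Derivation.leibniz, smul_eq_mul, Finset.sum_add_distrib, Finset.sum_mul]
    rw [add_comm]
    congr 1
    · simp only [mul_comm]
    · simp only [traceProd, Derivation.multiset_prod, goeDer_trace_pow]
      rw [sum_mul_multiset_sum (a := fun x y => (genSymm V ^ n) y x)
        (h := fun l x y => (genSymm V ^ (l - 1)) x y) (k := fun l => 2 * l)]
      refine congrArg Multiset.sum (Multiset.map_congr rfl fun l _ => ?_)
      rw [Multiset.map_cons, Multiset.prod_cons, pow_add, Matrix.trace, ← smul_mul_assoc,
        Finset.sum_comm]
      simp only [Matrix.diag, Matrix.mul_apply]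
  rw [goeMoment, h1, map_sum]
  simp only [map_sum, gaussExp_genSymm_mul]
  simp only [← map_sum]
  rw [h2, sum_goeDer_pow, map_add, add_mul, map_add, Finset.sum_mul, map_sum]
  congr 1
  · congr 1
    · refine Finset.sum_congr rfl fun i _ => ?_
      rw [goeMoment, traceProd_cons, traceProd_cons, mul_assoc]
    · rw [smul_mul_assoc, map_nsmul, ← traceProd_cons, nsmul_eq_mul, goeMoment]
  · rw [← Multiset.sum_hom, Multiset.map_map]
    refine congrArg Multiset.sum (Multiset.map_congr rfl fun l _ => ?_)
    rw [Function.comp_apply, map_nsmul, nsmul_eq_mul, goeMoment]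
    push_cast
    rfl

end GOE

/-! ### Supersolutions of the loop equations -/

/-- The loop equations have nonnegative coefficients, so a supersolution of product form dominates
the moments. `X n` is the price of replacing a factor `l` by the merged one; since the powers sum to
at most `M`, the merging terms together cost `2 * M * X n`, independently of `S`. -/
theorem goeMoment_le_prod {V : Type*} [Fintype V] [DecidableEq V] (M : ℕ) (C X : ℕ → ℝ)
    (hpos : ∀ l, 0 < C l) (hX : ∀ n, 0 ≤ X n) (h0 : (Fintype.card V : ℝ) ≤ C 0)
    (hmerge : ∀ n l, 1 ≤ l → n + 1 + l ≤ M → C (n + (l - 1)) ≤ X n * C l)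
    (hrec : ∀ n, n + 1 ≤ M → ∑ i ∈ Finset.range n, C i * C (n - 1 - i) + n * C (n - 1)
      + 2 * M * X n ≤ C (n + 1))
    (S : Multiset ℕ) (hS : S.sum ≤ M) : goeMoment V S ≤ (S.map C).prod := by
  -- Splitting lowers the sum by two and adds one factor; deleting a zero power removes one factor.
  -- The quantity drops in every case.
  induction hk : S.sum + S.card using Nat.strong_induction_on generalizing S with
  | _ k ih =>
  induction S using Multiset.induction_on with
  | empty => simp [goeMoment_zero]
  | cons n S _ =>
    have hprod : ∀ T : Multiset ℕ, 0 ≤ (T.map C).prod := fun T =>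
      Multiset.prod_nonneg fun a ha => by
        obtain ⟨l, _, rfl⟩ := Multiset.mem_map.1 ha
        exact (hpos l).le
    simp only [Multiset.sum_cons, Multiset.card_cons] at hk hS
    rcases n with _ | n
    · rw [goeMoment_cons_zero, Multiset.map_cons, Multiset.prod_cons]
      have h1 := ih _ (by omega) S (by omega) rfl
      calc (Fintype.card V : ℝ) * goeMoment V S ≤ Fintype.card V * (S.map C).prod := by gcongr
        _ ≤ _ := mul_le_mul_of_nonneg_right h0 (hprod S)
    · rw [goeMoment_cons_succ, Multiset.map_cons, Multiset.prod_cons]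
      have h1 : ∑ i ∈ Finset.range n, goeMoment V (i ::ₘ (n - 1 - i) ::ₘ S) ≤
          (∑ i ∈ Finset.range n, C i * C (n - 1 - i)) * (S.map C).prod := by
        rw [Finset.sum_mul]
        refine Finset.sum_le_sum fun i hi => ?_
        have hi := Finset.mem_range.1 hi
        refine (ih _ ?_ (i ::ₘ (n - 1 - i) ::ₘ S) ?_ rfl).trans ?_
        · simp only [Multiset.sum_cons, Multiset.card_cons]; omega
        · simp only [Multiset.sum_cons]; omega
        · simp [mul_assoc]
      have h2 : (n : ℝ) * goeMoment V ((n - 1) ::ₘ S) ≤ n * C (n - 1) * (S.map C).prod := by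
        rw [mul_assoc]
        refine mul_le_mul_of_nonneg_left ?_ n.cast_nonneg
        refine (ih _ ?_ ((n - 1) ::ₘ S) ?_ rfl).trans ?_
        · simp only [Multiset.sum_cons, Multiset.card_cons]; omega
        · simp only [Multiset.sum_cons]; omega
        · simp
      have h3 : (S.map fun l => 2 * l * goeMoment V ((n + (l - 1)) ::ₘ S.erase l)).sum ≤
          (2 * M * X n) * (S.map C).prod := by
        have h4 : (S.map fun l => 2 * l * goeMoment V ((n + (l - 1)) ::ₘ S.erase l)).sum ≤
            (S.map fun l : ℕ => (l : ℝ) * (2 * X n * (S.map C).prod)).sum := by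
          refine Multiset.sum_map_le_sum_map _ _ fun l hl => ?_
          rcases Nat.eq_zero_or_pos l with rfl | hl0
          · simp
          · have hle := Multiset.single_le_sum (fun _ _ => Nat.zero_le _) l hl
            have hsum : l + (S.erase l).sum = S.sum := Multiset.sum_erase hl
            have hcard : (S.erase l).card + 1 = S.card := Multiset.card_erase_add_one hl
            have h5 := ih (((n + (l - 1)) ::ₘ S.erase l).sum
                + ((n + (l - 1)) ::ₘ S.erase l).card) (by
                  simp only [Multiset.sum_cons, Multiset.card_cons]; omega)
                ((n + (l - 1)) ::ₘ S.erase l) (by simp only [Multiset.sum_cons]; omega) rfl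
            have h6 : (((n + (l - 1)) ::ₘ S.erase l).map C).prod ≤ X n * (S.map C).prod := by
              rw [Multiset.map_cons, Multiset.prod_cons]
              have : (S.map C).prod = C l * ((S.erase l).map C).prod := by
                rw [← Multiset.prod_cons, ← Multiset.map_cons, Multiset.cons_erase hl]
              rw [this, ← mul_assoc]
              exact mul_le_mul_of_nonneg_right (hmerge n l hl0 (by omega)) (hprod _)
            have h7 : (0 : ℝ) ≤ 2 * l := by positivity
            calc _ ≤ 2 * (l : ℝ) * (X n * (S.map C).prod) :=
                  mul_le_mul_of_nonneg_left (h5.trans h6) h7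
              _ = _ := by ring
        refine h4.trans ?_
        rw [Multiset.sum_map_mul_right]
        have h8 : (S.map fun l : ℕ => (l : ℝ)).sum = (S.sum : ℕ) := by
          rw [Nat.cast_multiset_sum]
        rw [h8]
        have h9 : ((S.sum : ℕ) : ℝ) ≤ M := by exact_mod_cast (by omega)
        have := mul_le_mul_of_nonneg_right h9
          (mul_nonneg (mul_nonneg zero_le_two (hX n)) (hprod S))
        linarith
      have h10 := mul_le_mul_of_nonneg_right (hrec n (by omega)) (hprod S)
      linarith

/-! ### Catalan numbers and central binomial coefficients -/

section Catalan

open Finset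

theorem centralBinom_succ_eq (n : ℕ) :
    (Nat.centralBinom (n + 1) : ℝ) = 4 * Nat.centralBinom n - 2 * catalan n := by
  have h1 : ((n + 1 : ℕ) : ℝ) * Nat.centralBinom (n + 1) = (2 * (2 * n + 1) : ℕ) * Nat.centralBinom n := by
    exact_mod_cast Nat.succ_mul_centralBinom_succ n
  have h2 : ((n + 1 : ℕ) : ℝ) * catalan n = Nat.centralBinom n := by
    exact_mod_cast succ_mul_catalan_eq_centralBinom n
  have h3 : ((n + 1 : ℕ) : ℝ) ≠ 0 := by positivity
  apply mul_left_cancel₀ h3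
  rw [h1]
  push_cast at *
  linear_combination (2 : ℝ) * h2

theorem sum_catalan_mul_catalan (n : ℕ) :
    ∑ i ∈ range (n + 1), (catalan i * catalan (n - i) : ℝ) = catalan (n + 1) := by
  rw [catalan_succ, ← Fin.sum_univ_eq_sum_range (fun i => (catalan i * catalan (n - i) : ℝ))]
  push_cast
  rfl

/-- Symmetrise under `i ↦ n - i`: the factors `i + 1` and `n - i + 1` add up to `n + 2`, leaving the
Catalan convolution. -/
theorem two_mul_sum_catalan_mul_centralBinom (n : ℕ) :
    2 * ∑ i ∈ range (n + 1), (catalan i * Nat.centralBinom (n - i) : ℝ) =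
      Nat.centralBinom (n + 1) := by
  have h1 : ∑ i ∈ range (n + 1), (catalan i * Nat.centralBinom (n - i) : ℝ) =
      ∑ i ∈ range (n + 1), (Nat.centralBinom i * catalan (n - i) : ℝ) := by
    rw [← Finset.sum_range_reflect]
    refine Finset.sum_congr rfl fun i hi => ?_
    have := mem_range.1 hi
    rw [show n + 1 - 1 - i = n - i by omega, show n - (n - i) = i by omega, mul_comm]
  have h2 : ∀ k : ℕ, (Nat.centralBinom k : ℝ) = (k + 1) * catalan k := fun k => by
    exact_mod_cast (succ_mul_catalan_eq_centralBinom k).symm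
  rw [two_mul]
  nth_rw 2 [h1]
  rw [← Finset.sum_add_distrib, h2 (n + 1), ← sum_catalan_mul_catalan, Finset.mul_sum]
  refine Finset.sum_congr rfl fun i hi => ?_
  have hi : i ≤ n := by have := mem_range.1 hi; omega
  rw [h2 i, h2 (n - i), Nat.cast_sub hi]
  push_cast
  ring

theorem sum_centralBinom_mul_centralBinom (n : ℕ) :
    ∑ i ∈ range (n + 1), (Nat.centralBinom i * Nat.centralBinom (n - i) : ℝ) = 4 ^ n := by
  induction n with
  | zero => simp
  | succ n ih =>
    rw [Finset.sum_range_succ']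
    have h : ∀ i ∈ range (n + 1), (Nat.centralBinom (i + 1) * Nat.centralBinom (n + 1 - (i + 1)) : ℝ)
        = 4 * (Nat.centralBinom i * Nat.centralBinom (n - i))
          - 2 * (catalan i * Nat.centralBinom (n - i)) := by
      intro i _
      rw [centralBinom_succ_eq, Nat.add_sub_add_right]; ring
    rw [Finset.sum_congr rfl h, Finset.sum_sub_distrib, ← Finset.mul_sum, ← Finset.mul_sum, ih,
      two_mul_sum_catalan_mul_centralBinom]
    simp [pow_succ']

theorem catalan_pos (n : ℕ) : 0 < catalan n := by
  have h := succ_mul_catalan_eq_centralBinom n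
  have := Nat.centralBinom_pos n
  by_contra h0
  simp only [not_lt, Nat.le_zero] at h0
  rw [h0] at h; omega

theorem catalan_succ_le (n : ℕ) : catalan (n + 1) ≤ 4 * catalan n := by
  have h1 := Nat.succ_mul_centralBinom_succ n
  rw [← succ_mul_catalan_eq_centralBinom, ← succ_mul_catalan_eq_centralBinom] at h1
  have h2 : (n + 1) * ((n + 2) * catalan (n + 1)) ≤ (n + 1) * ((n + 2) * (4 * catalan n)) := by
    calc _ = 2 * (2 * n + 1) * ((n + 1) * catalan n) := h1
      _ ≤ _ := by nlinarith [Nat.zero_le ((n + 1) * catalan n)]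
  exact Nat.le_of_mul_le_mul_left (Nat.le_of_mul_le_mul_left h2 (by omega)) (by omega)

theorem catalan_le_succ (n : ℕ) : catalan n ≤ catalan (n + 1) := by
  have h1 := Nat.succ_mul_centralBinom_succ n
  rw [← succ_mul_catalan_eq_centralBinom, ← succ_mul_catalan_eq_centralBinom] at h1
  have h2 : (n + 1) * ((n + 2) * catalan n) ≤ (n + 1) * ((n + 2) * catalan (n + 1)) := by
    calc _ ≤ 2 * (2 * n + 1) * ((n + 1) * catalan n) := by
          nlinarith [Nat.zero_le ((n + 1) * catalan n), Nat.zero_le (n * ((n + 1) * catalan n))]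
      _ = _ := h1.symm
  exact Nat.le_of_mul_le_mul_left (Nat.le_of_mul_le_mul_left h2 (by omega)) (by omega)

theorem catalan_add_le (k i : ℕ) : catalan (k + i) ≤ 4 ^ i * catalan k := by
  induction i with
  | zero => simp
  | succ i ih =>
    calc catalan (k + i + 1) ≤ 4 * catalan (k + i) := catalan_succ_le _
      _ ≤ 4 * (4 ^ i * catalan k) := by gcongr
      _ = _ := by ring

theorem centralBinom_succ_le (n : ℕ) : Nat.centralBinom (n + 1) ≤ 4 * Nat.centralBinom n := by
  have h1 := Nat.succ_mul_centralBinom_succ n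
  have : (n + 1) * Nat.centralBinom (n + 1) ≤ (n + 1) * (4 * Nat.centralBinom n) := by
    rw [h1]; nlinarith [Nat.zero_le (Nat.centralBinom n)]
  exact Nat.le_of_mul_le_mul_left this (by omega)

theorem centralBinom_add_le (k i : ℕ) :
    Nat.centralBinom (k + i) ≤ 4 ^ i * Nat.centralBinom k := by
  induction i with
  | zero => simp
  | succ i ih =>
    calc Nat.centralBinom (k + i + 1) ≤ 4 * Nat.centralBinom (k + i) := centralBinom_succ_le _
      _ ≤ 4 * (4 ^ i * Nat.centralBinom k) := by gcongr
      _ = _ := by ring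

theorem centralBinom_le_succ (n : ℕ) : Nat.centralBinom n ≤ Nat.centralBinom (n + 1) := by
  have h1 := Nat.succ_mul_centralBinom_succ n
  have : (n + 1) * Nat.centralBinom n ≤ (n + 1) * Nat.centralBinom (n + 1) := by
    rw [h1]; nlinarith [Nat.zero_le (Nat.centralBinom n)]
  exact Nat.le_of_mul_le_mul_left this (by omega)

theorem four_pow_le_mul_catalan {m : ℕ} (hm : 1 ≤ m) : 4 ^ m ≤ 4 * m ^ 2 * catalan m := by
  calc 4 ^ m ≤ 2 * m * Nat.centralBinom m := Nat.four_pow_le_two_mul_self_mul_centralBinom m hm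
    _ = 2 * m * ((m + 1) * catalan m) := by rw [succ_mul_catalan_eq_centralBinom]
    _ ≤ _ := by
      have : 2 * m * (m + 1) ≤ 4 * m ^ 2 := by nlinarith
      calc _ = 2 * m * (m + 1) * catalan m := by ring
        _ ≤ _ := Nat.mul_le_mul_right _ this

/-- Each of the `m + k + 1` terms of Vandermonde's sum is at most the right-hand side, and division
by `m + k + 1` turns the central binomial coefficient into a Catalan number. -/
theorem catalan_add_le_centralBinom_mul (m k : ℕ) :
    catalan (m + k) ≤ Nat.centralBinom m * Nat.centralBinom k := by
  have h1 : Nat.centralBinom (m + k) ≤ (m + k + 1) * (Nat.centralBinom m * Nat.centralBinom k) := by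
    rw [Nat.centralBinom_eq_two_mul_choose, mul_add, Nat.add_choose_eq]
    calc _ ≤ ∑ _ij ∈ antidiagonal (m + k), Nat.centralBinom m * Nat.centralBinom k :=
          Finset.sum_le_sum fun ij _ =>
            Nat.mul_le_mul (Nat.choose_le_centralBinom _ _) (Nat.choose_le_centralBinom _ _)
      _ = _ := by simp
  rw [← succ_mul_catalan_eq_centralBinom] at h1
  exact Nat.le_of_mul_le_mul_left h1 (by omega)

/-- A squared Wallis bound; the induction rests on (2m+1)(2m+3) ≤ 4(m+1)². -/
theorem centralBinom_sq_mul_le (m : ℕ) : Nat.centralBinom m ^ 2 * (2 * m + 1) ≤ 16 ^ m := by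
  induction m with
  | zero => simp
  | succ m ih =>
    have h1 := Nat.succ_mul_centralBinom_succ m
    have h2 : (m + 1) ^ 2 * (Nat.centralBinom (m + 1) ^ 2 * (2 * (m + 1) + 1)) ≤
        (m + 1) ^ 2 * 16 ^ (m + 1) := by
      calc _ = ((m + 1) * Nat.centralBinom (m + 1)) ^ 2 * (2 * m + 3) := by ring
        _ = 4 * ((2 * m + 1) * (2 * m + 3)) * (Nat.centralBinom m ^ 2 * (2 * m + 1)) := by
            rw [h1]; ring
        _ ≤ 4 * (4 * (m + 1) ^ 2) * 16 ^ m := by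
            refine Nat.mul_le_mul (Nat.mul_le_mul_left _ ?_) ih
            nlinarith
        _ = _ := by ring
    exact Nat.le_of_mul_le_mul_left h2 (by positivity)

theorem catalan_le_rpow {s : ℕ} (hs : 1 ≤ s) :
    (catalan s : ℝ) ≤ 4 ^ s * (s : ℝ) ^ (-(3 / 2) : ℝ) := by
  have hs0 : (0 : ℝ) < s := by exact_mod_cast hs
  have h1 : (Nat.centralBinom s : ℝ) ^ 2 * s ≤ (4 ^ s) ^ 2 := by
    have h : Nat.centralBinom s ^ 2 * s ≤ (4 ^ s) ^ 2 := by
      calc _ ≤ Nat.centralBinom s ^ 2 * (2 * s + 1) := by gcongr; omega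
        _ ≤ 16 ^ s := centralBinom_sq_mul_le s
        _ = _ := by rw [← pow_mul, mul_comm, pow_mul]; norm_num
    exact_mod_cast h
  have h2 : (Nat.centralBinom s : ℝ) * √s ≤ 4 ^ s := by
    refine le_of_sq_le_sq (α := ℝ) ?_ (by positivity)
    rw [mul_pow, Real.sq_sqrt hs0.le]; exact h1
  have h3 : (s : ℝ) * catalan s ≤ Nat.centralBinom s := by
    have : s * catalan s ≤ Nat.centralBinom s := by
      rw [← succ_mul_catalan_eq_centralBinom]; gcongr; omega
    exact_mod_cast this
  have h4 : (s : ℝ) ^ (-(3 / 2) : ℝ) = (s * √s)⁻¹ := by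
    rw [Real.rpow_neg hs0.le, Real.sqrt_eq_rpow, ← Real.rpow_one_add' hs0.le (by norm_num)]
    norm_num
  rw [h4, ← div_eq_mul_inv, le_div_iff₀ (by positivity)]
  calc (catalan s : ℝ) * (s * √s) = (s * catalan s) * √s := by ring
    _ ≤ Nat.centralBinom s * √s := by gcongr
    _ ≤ _ := h2

end Catalan

/-! ### An explicit supersolution and the resulting moment bound -/

section GOEBound

open Finset

theorem sum_range_two_mul_add_one {M : Type*} [AddCommMonoid M] (f : ℕ → M) (k : ℕ) :
    ∑ i ∈ range (2 * k + 1), f i = ∑ i ∈ range (k + 1), f (2 * i) + ∑ i ∈ range k, f (2 * i + 1) := by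
  induction k with
  | zero => simp
  | succ k ih =>
    rw [show 2 * (k + 1) + 1 = 2 * k + 1 + 1 + 1 by ring, sum_range_succ, sum_range_succ, ih,
      sum_range_succ _ (k + 1), sum_range_succ (fun i => f (2 * i + 1)) k,
      show 2 * k + 1 + 1 = 2 * (k + 1) by ring]
    abel

theorem sum_range_two_mul {M : Type*} [AddCommMonoid M] (f : ℕ → M) (k : ℕ) :
    ∑ i ∈ range (2 * k), f i = ∑ i ∈ range k, f (2 * i) + ∑ i ∈ range k, f (2 * i + 1) := by
  induction k with
  | zero => simp
  | succ k ih =>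
    rw [show 2 * (k + 1) = 2 * k + 1 + 1 by ring, sum_range_succ, sum_range_succ, ih,
      sum_range_succ _ k, sum_range_succ _ k]
    abel

/-- The bound on the contribution of a trace of the power `l` to the moments of the Gaussian
orthogonal ensemble of size `r`. -/
noncomputable def goeWeight (r δ β : ℝ) (l : ℕ) : ℝ :=
  if Even l then r ^ (l / 2 + 1) * catalan (l / 2) * β ^ (l / 2)
  else δ * r ^ (l / 2 + 1) * Nat.centralBinom (l / 2) * β ^ (l / 2)

theorem goeWeight_even (r δ β : ℝ) (m : ℕ) :
    goeWeight r δ β (2 * m) = r ^ (m + 1) * catalan m * β ^ m := by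
  simp [goeWeight]

theorem goeWeight_odd (r δ β : ℝ) (m : ℕ) :
    goeWeight r δ β (2 * m + 1) = δ * r ^ (m + 1) * Nat.centralBinom m * β ^ m := by
  have : (2 * m + 1) / 2 = m := by omega
  simp [goeWeight, this]

/-- The cost of merging a trace of the power `n + 1` into another trace. -/
noncomputable def goeMerge (r δ β s : ℝ) (n : ℕ) : ℝ :=
  if Even n then r ^ (n / 2) * β ^ (n / 2) * Nat.centralBinom (n / 2) * (δ * s ^ 2 / r + 1 / δ)
  else (4 * r * β) ^ (n / 2)

theorem goeMerge_even (r δ β s : ℝ) (m : ℕ) : goeMerge r δ β s (2 * m) =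
    r ^ m * β ^ m * Nat.centralBinom m * (δ * s ^ 2 / r + 1 / δ) := by
  simp [goeMerge]

theorem goeMerge_odd (r δ β s : ℝ) (m : ℕ) : goeMerge r δ β s (2 * m + 1) =
    (4 * r * β) ^ m := by
  have : (2 * m + 1) / 2 = m := by omega
  simp [goeMerge, this]

theorem four_pow_le_sq_mul_catalan {k s : ℕ} (hs : k + 1 ≤ s) :
    (4 : ℝ) ^ k ≤ (s : ℝ) ^ 2 * catalan (k + 1) := by
  have h : 4 * 4 ^ k ≤ 4 * (s ^ 2 * catalan (k + 1)) := by
    calc 4 * 4 ^ k = 4 ^ (k + 1) := by ring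
      _ ≤ 4 * (k + 1) ^ 2 * catalan (k + 1) := four_pow_le_mul_catalan (by omega)
      _ ≤ 4 * s ^ 2 * catalan (k + 1) := by gcongr
      _ = _ := by ring
  exact_mod_cast Nat.le_of_mul_le_mul_left h (by norm_num)

variable {r δ β : ℝ}

theorem goeWeight_pos (hr : 0 < r) (hδ : 0 < δ) (hβ : 0 < β) (l : ℕ) :
    0 < goeWeight r δ β l := by
  have h1 : ∀ n, (0 : ℝ) < catalan n := fun n => by exact_mod_cast catalan_pos n
  have h2 : ∀ n, (0 : ℝ) < Nat.centralBinom n := fun n => by exact_mod_cast Nat.centralBinom_pos n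
  unfold goeWeight
  split_ifs
  · have := h1 (l / 2); positivity
  · have := h2 (l / 2); positivity

theorem goeMerge_nonneg (hr : 0 < r) (hδ : 0 < δ) (hβ : 0 < β) (s : ℝ) (n : ℕ) :
    0 ≤ goeMerge r δ β s n := by
  unfold goeMerge
  split_ifs <;> positivity

/-- For even `n` merging flips the parity of `l`: making an odd trace from an even one costs `δ * s
^ 2 / r`, the converse costs `1 / δ`. The price may depend on `n` only, so `goeMerge` adds the two.
-/
theorem goeWeight_merge_le (hr : 0 < r) (hδ : 0 < δ) (hβ : 1 ≤ β) {s : ℕ} (n l : ℕ)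
    (hl : 1 ≤ l) (hls : n + 1 + l ≤ 2 * s) :
    goeWeight r δ β (n + (l - 1)) ≤ goeMerge r δ β s n * goeWeight r δ β l := by
  have hβ0 : 0 < β := by linarith
  obtain ⟨m, rfl | rfl⟩ := Nat.even_or_odd' n
  · obtain ⟨k, rfl | rfl⟩ := Nat.even_or_odd' l
    · obtain ⟨k, rfl⟩ : ∃ j, k = j + 1 := ⟨k - 1, by omega⟩
      rw [show 2 * m + (2 * (k + 1) - 1) = 2 * (m + k) + 1 by omega, goeWeight_odd, goeWeight_even,
        goeMerge_even]
      have h1 : (Nat.centralBinom (m + k) : ℝ) ≤ 4 ^ k * Nat.centralBinom m := by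
        exact_mod_cast centralBinom_add_le m k
      have h2 := four_pow_le_sq_mul_catalan (k := k) (s := s) (by omega)
      have h3 : (Nat.centralBinom (m + k) : ℝ) ≤
          ((s : ℝ) ^ 2 * catalan (k + 1)) * Nat.centralBinom m :=
        h1.trans (by gcongr)
      calc _ ≤ δ * r ^ (m + k + 1) * (((s : ℝ) ^ 2 * catalan (k + 1)) * Nat.centralBinom m)
              * β ^ (m + (k + 1)) := by
            gcongr
            · omega
        _ = r ^ m * β ^ m * Nat.centralBinom m * (δ * s ^ 2 / r)
            * (r ^ (k + 1 + 1) * catalan (k + 1) * β ^ (k + 1)) := by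
            field_simp
            ring
        _ ≤ _ := by
            gcongr
            have : 0 < 1 / δ := by positivity
            linarith
    · rw [show 2 * m + (2 * k + 1 - 1) = 2 * (m + k) by omega, goeWeight_odd, goeWeight_even,
        goeMerge_even]
      have h1 : (catalan (m + k) : ℝ) ≤ Nat.centralBinom m * Nat.centralBinom k := by
        exact_mod_cast catalan_add_le_centralBinom_mul m k
      calc _ ≤ r ^ (m + k + 1) * (Nat.centralBinom m * Nat.centralBinom k : ℝ) * β ^ (m + k) := by
            gcongr
        _ = r ^ m * β ^ m * Nat.centralBinom m * (1 / δ)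
            * (δ * r ^ (k + 1) * Nat.centralBinom k * β ^ k) := by
            field_simp
            ring
        _ ≤ _ := by
            gcongr
            have : 0 ≤ δ * (s : ℝ) ^ 2 / r := by positivity
            linarith
  · obtain ⟨k, rfl | rfl⟩ := Nat.even_or_odd' l
    · rw [show 2 * m + 1 + (2 * k - 1) = 2 * (k + m) by omega, goeWeight_even, goeWeight_even,
        goeMerge_odd]
      have h1 : (catalan (k + m) : ℝ) ≤ 4 ^ m * catalan k := by
        exact_mod_cast catalan_add_le k m
      calc _ ≤ r ^ (k + m + 1) * (4 ^ m * catalan k : ℝ) * β ^ (k + m) := by gcongr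
        _ = _ := by ring
    · rw [show 2 * m + 1 + (2 * k + 1 - 1) = 2 * (k + m) + 1 by omega, goeWeight_odd,
        goeWeight_odd, goeMerge_odd]
      have h1 : (Nat.centralBinom (k + m) : ℝ) ≤ 4 ^ m * Nat.centralBinom k := by
        exact_mod_cast centralBinom_add_le k m
      calc _ ≤ δ * r ^ (k + m + 1) * (4 ^ m * Nat.centralBinom k : ℝ) * β ^ (k + m) := by gcongr
        _ = _ := by ring

/-- Pairs of even powers reproduce the Catalan recursion; pairs of odd powers give `4 ^ k`, an error
made small by `δ ^ 2`. -/
theorem sum_goeWeight_even (hr : 0 < r) (hβ : 1 ≤ β) (k : ℕ) :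
    ∑ i ∈ range (2 * k + 1), goeWeight r δ β i * goeWeight r δ β (2 * k - i) ≤
      r ^ (k + 2) * β ^ k * catalan (k + 1) + δ ^ 2 * r ^ (k + 1) * β ^ k * 4 ^ k := by
  rw [sum_range_two_mul_add_one]
  gcongr
  · refine le_of_eq ?_
    rw [← sum_catalan_mul_catalan, mul_sum]
    refine sum_congr rfl fun i hi => ?_
    have hi := mem_range.1 hi
    rw [show 2 * k - 2 * i = 2 * (k - i) by omega, goeWeight_even, goeWeight_even]
    obtain ⟨j, rfl⟩ : ∃ j, k = i + j := ⟨k - i, by omega⟩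
    rw [Nat.add_sub_cancel_left]
    ring
  · rcases k with _ | k
    · simp; positivity
    · have h : ∑ i ∈ range (k + 1), goeWeight r δ β (2 * i + 1)
          * goeWeight r δ β (2 * (k + 1) - (2 * i + 1)) = δ ^ 2 * r ^ (k + 2) * β ^ k * 4 ^ k := by
        rw [← sum_centralBinom_mul_centralBinom, mul_sum]
        refine sum_congr rfl fun i hi => ?_
        have hi := mem_range.1 hi
        rw [show 2 * (k + 1) - (2 * i + 1) = 2 * (k - i) + 1 by omega, goeWeight_odd, goeWeight_odd]
        obtain ⟨j, rfl⟩ : ∃ j, k = i + j := ⟨k - i, by omega⟩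
        rw [Nat.add_sub_cancel_left]
        ring
      rw [h]
      gcongr
      all_goals first | omega | norm_num

/-- Exactly one index of each pair is odd, and the two possibilities contribute equally, which is
the factor two in the convolution of Catalan numbers with central binomial coefficients. -/
theorem sum_goeWeight_odd (hr : 0 < r) (hδ : 0 < δ) (hβ : 0 < β) (m : ℕ) :
    (∑ i ∈ range (2 * m), goeWeight r δ β i * goeWeight r δ β (2 * m - 1 - i)) * β ≤
      goeWeight r δ β (2 * m + 1) := by
  rcases m with _ | k
  · simpa using (goeWeight_pos hr hδ hβ 1).le
  · refine le_of_eq ?_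
    rw [goeWeight_odd, sum_range_two_mul, ← two_mul_sum_catalan_mul_centralBinom]
    have h1 : ∑ i ∈ range (k + 1), goeWeight r δ β (2 * i)
        * goeWeight r δ β (2 * (k + 1) - 1 - 2 * i) =
        δ * r ^ (k + 2) * β ^ k * ∑ i ∈ range (k + 1), (catalan i * Nat.centralBinom (k - i) : ℝ) := by
      rw [mul_sum]
      refine sum_congr rfl fun i hi => ?_
      have hi := mem_range.1 hi
      rw [show 2 * (k + 1) - 1 - 2 * i = 2 * (k - i) + 1 by omega, goeWeight_odd, goeWeight_even]
      obtain ⟨j, rfl⟩ : ∃ j, k = i + j := ⟨k - i, by omega⟩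
      rw [Nat.add_sub_cancel_left]
      ring
    have h2 : ∑ i ∈ range (k + 1), goeWeight r δ β (2 * i + 1)
        * goeWeight r δ β (2 * (k + 1) - 1 - (2 * i + 1)) =
        ∑ i ∈ range (k + 1), goeWeight r δ β (2 * i)
        * goeWeight r δ β (2 * (k + 1) - 1 - 2 * i) := by
      rw [← Finset.sum_range_reflect]
      refine sum_congr rfl fun i hi => ?_
      have hi := mem_range.1 hi
      rw [mul_comm]
      congr 2 <;> omega
    rw [h2, h1]
    ring

/-- The leading terms lack one factor β = 1 + 1/s, which leaves a relative slack of order 1/s for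
everything else. For even powers the products of two odd weights take half of it, which dictates δ²
= r/(2s³). For odd powers the merging terms then cost a multiple of s · s³/r², which fits the slack
once s^5 is small against r². -/
theorem goeWeight_rec {s : ℕ} (hs : 1 ≤ s) (hr : 0 < r) (hδ : 0 < δ)
    (hrs : 100 * (s : ℝ) ^ 5 ≤ r ^ 2) (hδr : δ ^ 2 = r / (2 * s ^ 3)) (n : ℕ)
    (hn : n + 1 ≤ 2 * s) :
    ∑ i ∈ range n, goeWeight r δ (1 + 1 / s) i * goeWeight r δ (1 + 1 / s) (n - 1 - i)
      + n * goeWeight r δ (1 + 1 / s) (n - 1) + 2 * (2 * s : ℕ) * goeMerge r δ (1 + 1 / s) s n ≤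
      goeWeight r δ (1 + 1 / s) (n + 1) := by
  have hs1 : (1 : ℝ) ≤ s := by exact_mod_cast hs
  have hs0 : (0 : ℝ) < s := by linarith
  have hrs2 : 10 * (s : ℝ) ^ 2 ≤ r := by
    refine le_of_sq_le_sq (α := ℝ) ?_ hr.le
    calc (10 * (s : ℝ) ^ 2) ^ 2 = 100 * (s : ℝ) ^ 4 * 1 := by ring
      _ ≤ 100 * (s : ℝ) ^ 4 * s := by gcongr
      _ = 100 * (s : ℝ) ^ 5 := by ring
      _ ≤ _ := hrs
  have hrs4 : 100 * (s : ℝ) ^ 4 ≤ r ^ 2 := by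
    calc 100 * (s : ℝ) ^ 4 = (10 * (s : ℝ) ^ 2) ^ 2 := by ring
      _ ≤ _ := by gcongr
  set β : ℝ := 1 + 1 / s with hβdef
  have hβ1 : 1 ≤ β := by
    have : 0 < 1 / (s : ℝ) := by positivity
    linarith
  have hβ2 : β ≤ 2 := by
    have : 1 / (s : ℝ) ≤ 1 := by rw [div_le_one hs0]; exact hs1
    linarith
  have hβ0 : 0 < β := by linarith
  obtain ⟨m, rfl | rfl⟩ := Nat.even_or_odd' n
  · set D := goeWeight r δ β (2 * m + 1) with hD
    have hD0 : 0 < D := goeWeight_pos hr hδ hβ0 _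
    have e1 := sum_goeWeight_odd (r := r) (δ := δ) (β := β) hr hδ hβ0 m
    have e2 : ((2 * m : ℕ) : ℝ) * goeWeight r δ β (2 * m - 1) * (β * r) ≤ 2 * s * D := by
      rcases m with _ | k
      · simp; positivity
      · rw [show 2 * (k + 1) - 1 = 2 * k + 1 by omega, hD, goeWeight_odd, goeWeight_odd]
        have h1 : ((2 * (k + 1) : ℕ) : ℝ) ≤ 2 * s := by exact_mod_cast (by omega)
        have h2 : (Nat.centralBinom k : ℝ) ≤ Nat.centralBinom (k + 1) := by
          exact_mod_cast centralBinom_le_succ k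
        calc _ = ((2 * (k + 1) : ℕ) : ℝ) * (δ * r ^ (k + 1 + 1) * Nat.centralBinom k * β ^ (k + 1)) := by
              ring
          _ ≤ _ := by gcongr
    have e3 : goeMerge r δ β s (2 * m) = D * (s ^ 2 / r ^ 2 + 2 * s ^ 3 / r ^ 2) := by
      rw [goeMerge_even, hD, goeWeight_odd]
      have : 1 / δ = δ * (2 * s ^ 3 / r) := by
        have h : δ * δ = r / (2 * s ^ 3) := by rw [← hδr]; ring
        rw [div_eq_iff hδ.ne']
        calc (1 : ℝ) = (r / (2 * s ^ 3)) * (2 * s ^ 3 / r) := by field_simp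
          _ = _ := by rw [← h]; ring
      rw [this]
      field_simp
      ring
    have e2' : ((2 * m : ℕ) : ℝ) * goeWeight r δ β (2 * m - 1) * β ≤ D * (1 / (4 * s)) := by
      have h1 : 2 * s * D ≤ D * (1 / (4 * s)) * r := by
        have : 2 * (s : ℝ) ≤ (1 / (4 * s)) * r := by
          rw [div_mul_eq_mul_div, le_div_iff₀ (by positivity)]
          nlinarith
        nlinarith
      have h2 := e2.trans h1
      rw [← mul_assoc] at h2
      exact le_of_mul_le_mul_right h2 hr
    have e3' : 2 * ((2 * s : ℕ) : ℝ) * goeMerge r δ β s (2 * m) * β ≤ D * (3 / (4 * s)) := by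
      rw [e3]
      have h1 : s ^ 2 / r ^ 2 + 2 * s ^ 3 / r ^ 2 ≤ 3 / (100 * (s : ℝ) ^ 2) := by
        rw [← add_div, div_le_div_iff₀ (by positivity) (by positivity)]
        have : (s : ℝ) ^ 2 + 2 * s ^ 3 ≤ 3 * s ^ 3 := by nlinarith [sq_nonneg (s : ℝ)]
        calc _ ≤ (3 * (s : ℝ) ^ 3) * (100 * s ^ 2) := by gcongr
          _ = 3 * (100 * (s : ℝ) ^ 5) := by ring
          _ ≤ 3 * r ^ 2 := by gcongr
      push_cast
      calc 2 * (2 * (s : ℝ)) * (D * (s ^ 2 / r ^ 2 + 2 * s ^ 3 / r ^ 2)) * β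
          ≤ 2 * (2 * (s : ℝ)) * (D * (3 / (100 * (s : ℝ) ^ 2))) * 2 := by gcongr
        _ = D * (24 / (100 * s)) := by field_simp; norm_num
        _ ≤ D * (3 / (4 * s)) := by
          gcongr D * ?_
          rw [div_le_div_iff₀ (by positivity) (by positivity)]
          nlinarith
    -- The regluing term and the merging terms take one and three quarters of the slack.
    have h5 : D * (1 / (4 * s)) + D * (3 / (4 * s)) + D = D * β := by
      rw [hβdef]; field_simp; ring
    refine le_of_mul_le_mul_right ?_ hβ0
    rw [add_mul, add_mul, ← h5]
    linarith
  · have hms : m + 1 ≤ s := by omega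
    have e1 := sum_goeWeight_even (r := r) (δ := δ) (β := β) hr hβ1 m
    rw [show 2 * m + 1 - 1 = 2 * m by omega, show 2 * m + 1 + 1 = 2 * (m + 1) by ring,
      goeWeight_even, goeWeight_even, goeMerge_odd]
    have h1 := four_pow_le_sq_mul_catalan hms
    have h2 : (catalan m : ℝ) ≤ catalan (m + 1) := by exact_mod_cast catalan_le_succ m
    have h3 : ((2 * m + 1 : ℕ) : ℝ) ≤ 2 * s := by exact_mod_cast (by omega)
    have hc : (0 : ℝ) < catalan (m + 1) := by exact_mod_cast catalan_pos _
    have key : δ ^ 2 * r * (s ^ 2 * catalan (m + 1)) + 2 * s * (r * catalan (m + 1))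
        + 4 * s * (s ^ 2 * catalan (m + 1)) ≤ r ^ 2 * catalan (m + 1) * (1 / s) := by
      rw [hδr]
      have : r / (2 * s ^ 3) * r * s ^ 2 + 2 * s * r + 4 * s ^ 3 ≤ r ^ 2 * (1 / s) := by
        -- Half of the slack goes here; the two other terms take a quarter each.
        have t1 : r / (2 * s ^ 3) * r * s ^ 2 = r ^ 2 * (1 / s) / 2 := by field_simp
        have t2 : 2 * s * r ≤ r ^ 2 * (1 / s) / 4 := by
          rw [mul_one_div, div_div, le_div_iff₀ (by positivity)]
          nlinarith
        have t3 : 4 * (s : ℝ) ^ 3 ≤ r ^ 2 * (1 / s) / 4 := by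
          rw [mul_one_div, div_div, le_div_iff₀ (by positivity)]
          nlinarith [sq_nonneg (s : ℝ), sq_nonneg ((s : ℝ) ^ 2)]
        linarith
      nlinarith
    calc _ ≤ (r ^ (m + 2) * β ^ m * catalan (m + 1) + δ ^ 2 * r ^ (m + 1) * β ^ m * 4 ^ m)
          + 2 * s * (r ^ (m + 1) * catalan (m + 1) * β ^ m) + 4 * s * (4 * r * β) ^ m := by
          refine add_le_add (add_le_add e1 ?_) ?_
          · gcongr
          · push_cast; apply le_of_eq; ring
      _ = r ^ (m + 2) * β ^ m * catalan (m + 1) + r ^ m * β ^ m * (δ ^ 2 * r * 4 ^ m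
          + 2 * s * (r * catalan (m + 1)) + 4 * s * 4 ^ m) := by rw [mul_pow, mul_pow]; ring
      _ ≤ r ^ (m + 2) * β ^ m * catalan (m + 1) + r ^ m * β ^ m *
          (r ^ 2 * catalan (m + 1) * (1 / s)) := by
          gcongr
          refine le_trans ?_ key
          gcongr
      _ = _ := by rw [hβdef]; ring

theorem goeMoment_two_mul_le {V : Type*} [Fintype V] [DecidableEq V] {s : ℕ} (hs : 1 ≤ s)
    (hV : 100 * s ^ 5 ≤ Fintype.card V ^ 2) :
    goeMoment V {2 * s} ≤ 3 * (Fintype.card V : ℝ) ^ (s + 1) * catalan s := by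
  have hs0 : (0 : ℝ) < s := by exact_mod_cast hs
  set r : ℝ := (Fintype.card V : ℝ) with hr
  have hrs : 100 * (s : ℝ) ^ 5 ≤ r ^ 2 := by rw [hr]; exact_mod_cast hV
  have hr0 : 0 < r := by
    refine lt_of_le_of_ne (by positivity) fun h => ?_
    rw [← h] at hrs
    have : 0 < (s : ℝ) ^ 5 := by positivity
    nlinarith
  have hδ0 : 0 < √(r / (2 * s ^ 3)) := by positivity
  have hβ : (1 : ℝ) ≤ 1 + 1 / s := by
    have : 0 < 1 / (s : ℝ) := by positivity
    linarith
  have h := goeMoment_le_prod (V := V) (2 * s) (goeWeight r √(r / (2 * s ^ 3)) (1 + 1 / s))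
    (goeMerge r √(r / (2 * s ^ 3)) (1 + 1 / s) s) (goeWeight_pos hr0 hδ0 (by linarith))
    (goeMerge_nonneg hr0 hδ0 (by linarith) s)
    (by have := goeWeight_even r √(r / (2 * s ^ 3)) (1 + 1 / s) 0
        rw [mul_zero] at this
        rw [this]; simp [hr])
    (fun n l => goeWeight_merge_le hr0 hδ0 hβ n l)
    (goeWeight_rec hs hr0 hδ0 hrs (Real.sq_sqrt (by positivity))) {2 * s} (by simp)
  rw [Multiset.map_singleton, Multiset.prod_singleton, goeWeight_even] at h
  have h2 : (1 + 1 / (s : ℝ)) ^ s ≤ 3 := by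
    calc (1 + 1 / (s : ℝ)) ^ s ≤ (Real.exp (1 / s)) ^ s := by
          gcongr
          rw [add_comm]; exact Real.add_one_le_exp _
      _ = Real.exp 1 := by rw [← Real.exp_nat_mul]; congr 1; field_simp
      _ ≤ 3 := by have := Real.exp_one_lt_d9; linarith
  calc _ ≤ _ := h
    _ ≤ r ^ (s + 1) * catalan s * 3 := by gcongr
    _ = _ := by ring

end GOEBound

/-! ### Even closed walks and the comparison with a complete graph -/

section Walks

open Finset

theorem Matrix.pow_apply_eq_sum_walks {R V : Type*} [CommSemiring R] [Fintype V] [DecidableEq V]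
    (M : Matrix V V R) (n : ℕ) (x y : V) : (M ^ n) x y =
      ∑ u : Fin (n + 1) → V, if u 0 = x ∧ u (Fin.last n) = y then
        ∏ i : Fin n, M (u i.castSucc) (u i.succ) else 0 := by
  induction n generalizing x with
  | zero =>
    rw [← (Equiv.funUnique (Fin 1) V).symm.sum_comp]
    simp only [Equiv.funUnique_symm_apply, uniqueElim_const, Finset.univ_eq_empty,
      Finset.prod_empty, pow_zero, Matrix.one_apply, ite_and]
    simp
  | succ n ih =>
    rw [pow_succ', Matrix.mul_apply, ← (Fin.consEquiv fun _ => V).sum_comp, Fintype.sum_prod_type]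
    symm
    simp only [ih, Fin.consEquiv_apply, Fin.cons_zero, ← Fin.succ_last, Fin.cons_succ, ite_and]
    rw [Finset.sum_eq_single x]
    · simp only [if_true, Finset.mul_sum]
      rw [Finset.sum_comm (s := univ (α := V))]
      refine Finset.sum_congr rfl fun u _ => ?_
      rw [Finset.sum_eq_single (u 0)]
      · simp only [if_true, mul_ite, mul_zero, Fin.prod_univ_succ, Fin.castSucc_zero,
          Fin.cons_zero, Fin.cons_succ, ← Fin.succ_castSucc]
      · intro b _ hb
        simp [hb.symm]
      · simp
    · intro b _ hb
      simp [hb]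
    · simp

theorem Matrix.trace_pow_eq_sum_walks {R V : Type*} [CommSemiring R] [Fintype V] [DecidableEq V]
    (M : Matrix V V R) (n : ℕ) : (M ^ n).trace =
      ∑ u : Fin (n + 1) → V with u 0 = u (Fin.last n), ∏ i : Fin n, M (u i.castSucc) (u i.succ) := by
  simp only [Matrix.trace, Matrix.diag, Matrix.pow_apply_eq_sum_walks]
  rw [Finset.sum_comm, Finset.sum_filter]
  refine Finset.sum_congr rfl fun u _ => ?_
  simp only [ite_and]
  rw [Finset.sum_ite_eq]
  simp [eq_comm]

variable {V W : Type*} {n : ℕ}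

/-- The undirected edge used by a walk at step `i`. -/
def walkEdge (u : Fin (n + 1) → V) (i : Fin n) : Sym2 V := s(u i.castSucc, u i.succ)

open Classical in
/-- Closed walks that use every undirected edge an even number of times. -/
def IsEvenClosed (u : Fin (n + 1) → V) : Prop :=
  u 0 = u (Fin.last n) ∧ ∀ j : Fin n, Even (#{i : Fin n | walkEdge u i = walkEdge u j})

open Classical in
/-- The number of distinct undirected edges of a walk. -/
noncomputable def edgeCount (u : Fin (n + 1) → V) : ℕ := #(univ.image (walkEdge u))

open Classical in
/-- The number of even closed walks of length `n`. -/
noncomputable def evenClosedCount (V : Type*) [Fintype V] (n : ℕ) : ℕ :=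
  #{u : Fin (n + 1) → V | IsEvenClosed u}

theorem evenClosedCount_le_goeMoment (V : Type*) [Fintype V] [DecidableEq V] (n : ℕ) :
    (evenClosedCount V n : ℝ) ≤ goeMoment V {n} := by
  classical
  rw [goeMoment, traceProd, Multiset.map_singleton, Multiset.prod_singleton,
    Matrix.trace_pow_eq_sum_walks, map_sum, evenClosedCount, Finset.card_eq_sum_ones]
  push_cast
  have hc : ∀ e : Sym2 V, (1 : ℝ) ≤ goeVar e := fun e => by
    unfold goeVar; split_ifs <;> norm_num
  have hmon : ∀ u : Fin (n + 1) → V, ∏ i : Fin n, genSymm V (u i.castSucc) (u i.succ) =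
      MvPolynomial.monomial (∑ i : Fin n, Finsupp.single (walkEdge u i) 1) 1 := by
    intro u
    rw [MvPolynomial.monomial_sum_one]
    rfl
  have hsub : ({u : Fin (n + 1) → V | IsEvenClosed u} : Finset _) ⊆
      ({u : Fin (n + 1) → V | u 0 = u (Fin.last n)} : Finset _) := by
    intro u hu
    simp only [Finset.mem_filter, Finset.mem_univ, true_and] at hu ⊢
    exact hu.1
  refine le_trans (Finset.sum_le_sum fun u hu => ?_)
    (Finset.sum_le_sum_of_subset_of_nonneg hsub fun u _ _ => ?_)
  · rw [hmon]
    simp only [Finset.mem_filter, Finset.mem_univ, true_and] at hu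
    refine one_le_gaussExp_monomial hc _ fun e => ?_
    rw [Finsupp.finsetSum_apply]
    simp only [Finsupp.single_apply]
    rw [Finset.sum_boole, Nat.cast_id]
    by_cases h : ∃ j, walkEdge u j = e
    · obtain ⟨j, rfl⟩ := h
      convert hu.2 j
    · push Not at h
      simp [h]
  · rw [hmon]
    exact gaussExp_monomial_nonneg (fun e => zero_le_one.trans (hc e)) _

open Classical in
/-- The first time at which a sequence takes the value that it has at time `i`. -/
noncomputable def firstOcc (u : Fin (n + 1) → V) (i : Fin (n + 1)) : Fin (n + 1) :=
  ({j | u j = u i} : Finset (Fin (n + 1))).min' ⟨i, by simp⟩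

theorem apply_firstOcc (u : Fin (n + 1) → V) (i : Fin (n + 1)) : u (firstOcc u i) = u i := by
  classical
  have h := Finset.min'_mem ({j | u j = u i} : Finset (Fin (n + 1))) ⟨i, by simp⟩
  unfold firstOcc
  simpa using h

theorem firstOcc_le {u : Fin (n + 1) → V} {i j : Fin (n + 1)} (h : u j = u i) :
    firstOcc u i ≤ j := by
  classical
  unfold firstOcc
  exact Finset.min'_le _ _ (by simpa using h)

/-- `firstOcc u` encodes which vertices of the walk coincide, and so allows walks on different
vertex sets to be compared. -/
theorem firstOcc_eq_of_ker {u : Fin (n + 1) → V} {w : Fin (n + 1) → W}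
    (h : ∀ i j, u i = u j ↔ w i = w j) : firstOcc u = firstOcc w := by
  classical
  funext i
  unfold firstOcc
  congr 1
  ext j
  simp [h]

theorem firstOcc_eq_iff (u : Fin (n + 1) → V) (i j : Fin (n + 1)) :
    firstOcc u i = firstOcc u j ↔ u i = u j := by
  classical
  refine ⟨fun h => ?_, fun h => ?_⟩
  · exact (apply_firstOcc u i).symm.trans ((congrArg u h).trans (apply_firstOcc u j))
  · unfold firstOcc
    congr 1
    ext k
    simp [h]

theorem firstOcc_idem (u : Fin (n + 1) → V) (i : Fin (n + 1)) :
    firstOcc u (firstOcc u i) = firstOcc u i :=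
  (firstOcc_eq_iff u _ _).2 (apply_firstOcc u i)

theorem walkEdge_eq_iff_of_ker {u : Fin (n + 1) → V} {w : Fin (n + 1) → W}
    (h : ∀ i j, u i = u j ↔ w i = w j) (i j : Fin n) :
    walkEdge u i = walkEdge u j ↔ walkEdge w i = walkEdge w j := by
  simp only [walkEdge, Sym2.eq_iff, h]

theorem IsEvenClosed.of_ker {u : Fin (n + 1) → V} {w : Fin (n + 1) → W}
    (h : ∀ i j, u i = u j ↔ w i = w j) (hu : IsEvenClosed u) : IsEvenClosed w := by
  classical
  refine ⟨(h _ _).1 hu.1, fun j => ?_⟩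
  have := hu.2 j
  rwa [Finset.filter_congr fun i _ => walkEdge_eq_iff_of_ker h i j] at this

/-- The number of steps at which a sequence takes a new value, in terms of its pattern. -/
def newCount (p : Fin (n + 1) → Fin (n + 1)) : ℕ := #{i : Fin n | p i.succ = i.succ}

/-- The edge that enters a new vertex has not been used before. -/
theorem newCount_le_edgeCount (u : Fin (n + 1) → V) : newCount (firstOcc u) ≤ edgeCount u := by
  classical
  refine Finset.card_le_card_of_injOn (walkEdge u) (fun i _ => by simp) ?_
  have key : ∀ i j : Fin n, firstOcc u j.succ = j.succ → i < j →
      walkEdge u i ≠ walkEdge u j := by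
    intro i j hj hij h
    have hnew : ∀ k : Fin (n + 1), u k = u j.succ → j.succ ≤ k := fun k hk => by
      rw [← hj]; exact firstOcc_le hk
    rw [walkEdge, walkEdge, Sym2.eq_iff] at h
    rcases h with ⟨_, h⟩ | ⟨h, _⟩
    · exact absurd (hnew _ h) (by simpa using hij)
    · have := hnew _ h
      rw [Fin.le_def] at this
      simp only [Fin.val_succ, Fin.val_castSucc] at this
      have := Fin.lt_def.1 hij
      omega
  intro i hi j hj hij
  simp only [Finset.coe_filter, Finset.mem_univ, true_and, Set.mem_ofPred_eq] at hi hj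
  rcases lt_trichotomy i j with h | h | h
  · exact absurd hij (key i j hj h)
  · exact h
  · exact absurd hij.symm (key j i hi h)

theorem IsEvenClosed.two_mul_edgeCount_le {u : Fin (n + 1) → V} (hu : IsEvenClosed u) :
    2 * edgeCount u ≤ n := by
  classical
  have h := Finset.card_eq_sum_card_image (walkEdge u) univ
  rw [Finset.card_univ, Fintype.card_fin] at h
  have h2 : ∑ _e ∈ univ.image (walkEdge u), 2 ≤
      ∑ e ∈ univ.image (walkEdge u), #{i : Fin n | walkEdge u i = e} := by
    refine Finset.sum_le_sum fun e he => ?_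
    obtain ⟨j, _, rfl⟩ := Finset.mem_image.1 he
    have h3 := hu.2 j
    have h4 : 0 < #{i : Fin n | walkEdge u i = walkEdge u j} :=
      Finset.card_pos.2 ⟨j, by simp⟩
    obtain ⟨k, hk⟩ := h3
    have : #{i : Fin n | walkEdge u i = walkEdge u j} = k + k := by convert hk
    omega
  rw [Finset.sum_const, smul_eq_mul] at h2
  rw [edgeCount, mul_comm]
  exact h2.trans h.symm.le

open Classical in
-- Only the start and the steps to new vertices involve a choice, the latter among at most `d`
-- neighbours; the pattern determines every other vertex.
theorem card_walks_with_pattern_le [Fintype V] (B : V → V → Prop) (d : ℕ)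
    (hd : ∀ x, #{y | B x y} ≤ d) (p : Fin (n + 1) → Fin (n + 1)) :
    #{u : Fin (n + 1) → V | (∀ i : Fin n, B (u i.castSucc) (u i.succ)) ∧ firstOcc u = p} ≤
      Fintype.card V * d ^ newCount p := by
  have nb : ∀ x, Nonempty ({y // B x y} ↪ Fin d) := fun x =>
    Function.Embedding.nonempty_of_card_le (by
      rw [Fintype.card_subtype, Fintype.card_fin]; exact hd x)
  replace nb := fun x => (nb x).some
  have hcard : Fintype.card V * d ^ newCount p =
      Fintype.card (V × ({i : Fin n // p i.succ = i.succ} → Fin d)) := by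
    simp [newCount, Fintype.card_subtype]
  rw [hcard, ← Fintype.card_subtype]
  refine Fintype.card_le_of_injective
    (fun u => (u.1 0, fun i => nb (u.1 i.1.castSucc) ⟨u.1 i.1.succ, u.2.1 i.1⟩)) ?_
  rintro ⟨u, hu, hup⟩ ⟨w, hw, hwp⟩ h
  rw [Prod.mk.injEq] at h
  obtain ⟨h0, h1⟩ := h
  have key : ∀ k : ℕ, ∀ hk : k < n + 1, u ⟨k, hk⟩ = w ⟨k, hk⟩ := by
    intro k
    induction k using Nat.strong_induction_on with
    | _ k ih =>
    intro hk
    rcases k with _ | k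
    · exact h0
    · by_cases hp : p ⟨k + 1, hk⟩ = ⟨k + 1, hk⟩
      · have h2 := congrFun h1 ⟨⟨k, by omega⟩, hp⟩
        simp only [Fin.castSucc_mk, Fin.succ_mk] at h2
        have h3 := ih k (by omega) (by omega)
        have h4 : ∀ (x x' : V) (y y' : V) (hy : B x y) (hy' : B x' y'), x = x' →
            nb x ⟨y, hy⟩ = nb x' ⟨y', hy'⟩ → y = y' := by
          rintro x _ y y' hy hy' rfl h
          exact congrArg Subtype.val ((nb x).injective h)
        exact h4 _ _ _ _ _ _ h3 h2
      · have hle : p ⟨k + 1, hk⟩ ≤ ⟨k + 1, hk⟩ := by rw [← hup]; exact firstOcc_le rfl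
        have hlt : p ⟨k + 1, hk⟩ < ⟨k + 1, hk⟩ := lt_of_le_of_ne hle hp
        have h2 := ih (p ⟨k + 1, hk⟩).1 (by simpa [Fin.lt_def] using hlt) (Fin.is_lt _)
        rw [Fin.eta] at h2
        rw [← apply_firstOcc u, ← apply_firstOcc w, hup, hwp]
        exact h2
  apply Subtype.ext
  funext i
  exact key i.1 i.2

open Classical in
-- The distinct vertices, namely the start and the new ones, can be sent injectively into `Fin r`.
theorem descFactorial_le_card_pattern (u : Fin (n + 1) → V) (r : ℕ) :
    r.descFactorial (newCount (firstOcc u) + 1) ≤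
      #{w : Fin (n + 1) → Fin r | firstOcc w = firstOcc u} := by
  have hcard : r.descFactorial (newCount (firstOcc u) + 1) =
      Fintype.card ({i // firstOcc u i = i} ↪ Fin r) := by
    rw [Fintype.card_embedding_eq, Fintype.card_fin, Fintype.card_subtype,
      Fin.card_filter_univ_succ, if_pos, newCount]
    · exact le_antisymm (firstOcc_le rfl) (Fin.zero_le _)
  rw [hcard, ← Fintype.card_subtype]
  refine Fintype.card_le_of_injective
    (fun f => ⟨fun i => f ⟨firstOcc u i, firstOcc_idem u i⟩, ?_⟩) ?_
  · refine firstOcc_eq_of_ker fun i j => ?_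
    rw [f.injective.eq_iff, Subtype.mk.injEq, firstOcc_eq_iff]
  · intro f g h
    ext i
    have h2 := congrFun (congrArg Subtype.val h) i.1
    simp only [i.2, Subtype.coe_eta] at h2
    rw [h2]

open Classical in
/-- Comparison of even closed walks in a graph of degree at most `d` with those in a complete
graph. -/
theorem sum_evenClosed_le [Fintype V] (B : V → V → Prop) (d : ℕ) (hd : ∀ x, #{y | B x y} ≤ d)
    {K : ℝ} (hK : 1 ≤ K) {r s : ℕ} (hrs : s ≤ r) (hr : (d : ℝ) ≤ K ^ 2 * (r - s : ℕ)) :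
    r * ∑ u : Fin (2 * s + 1) → V with IsEvenClosed u ∧ ∀ i : Fin (2 * s), B (u i.castSucc) (u i.succ),
        K ^ (2 * s - 2 * edgeCount u) ≤
      Fintype.card V * K ^ (2 * s) * evenClosedCount (Fin r) (2 * s) := by
  have hK0 : 0 < K := by linarith
  set S : Finset (Fin (2 * s + 1) → V) :=
    {u | IsEvenClosed u ∧ ∀ i : Fin (2 * s), B (u i.castSucc) (u i.succ)} with hS
  rw [evenClosedCount, ← Finset.sum_fiberwise S firstOcc,
    Finset.card_eq_sum_card_fiberwise (f := firstOcc) (t := univ) (by intro _ _; simp)]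
  push_cast
  rw [Finset.mul_sum, Finset.mul_sum]
  refine Finset.sum_le_sum fun p _ => ?_
  by_cases hp : ∃ u ∈ S, firstOcc u = p
  · obtain ⟨u₀, hu₀, rfl⟩ := hp
    rw [hS, Finset.mem_filter] at hu₀
    have hu₀ := hu₀.2
    set k := newCount (firstOcc u₀) with hk
    have hks : k ≤ s := by
      have h1 := newCount_le_edgeCount u₀
      have h2 := hu₀.1.two_mul_edgeCount_le
      omega
    have h1 : ∑ u ∈ S with firstOcc u = firstOcc u₀, K ^ (2 * s - 2 * edgeCount u) ≤
        (Fintype.card V * d ^ k) * K ^ (2 * s - 2 * k) := by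
      have hle : ∀ u ∈ ({u ∈ S | firstOcc u = firstOcc u₀} : Finset _),
          K ^ (2 * s - 2 * edgeCount u) ≤ K ^ (2 * s - 2 * k) := by
        intro u hu
        have h2 := newCount_le_edgeCount u
        rw [(Finset.mem_filter.1 hu).2] at h2
        exact pow_le_pow_right₀ hK (by omega)
      refine (Finset.sum_le_card_nsmul _ _ _ hle).trans ?_
      rw [nsmul_eq_mul]
      refine mul_le_mul_of_nonneg_right ?_ (by positivity)
      have h3 : #{u ∈ S | firstOcc u = firstOcc u₀} ≤ Fintype.card V * d ^ k := by
        refine (Finset.card_le_card ?_).trans (card_walks_with_pattern_le B d hd (firstOcc u₀))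
        intro u hu
        simp only [hS, Finset.mem_filter, Finset.mem_univ, true_and] at hu ⊢
        exact ⟨hu.1.2, hu.2⟩
      exact_mod_cast h3
    have h2 : r * (r - k) ^ k ≤
        #{w ∈ ({w | IsEvenClosed w} : Finset (Fin (2 * s + 1) → Fin r)) |
          firstOcc w = firstOcc u₀} := by
      have h3 : r * (r - k) ^ k ≤ r.descFactorial (k + 1) := by
        rcases r with _ | r
        · simp
        · rw [Nat.succ_descFactorial_succ]
          exact Nat.mul_le_mul_left _ (Nat.pow_sub_le_descFactorial r k)
      refine (h3.trans (descFactorial_le_card_pattern u₀ r)).trans (Finset.card_le_card ?_)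
      intro w hw
      simp only [Finset.mem_filter, Finset.mem_univ, true_and] at hw ⊢
      refine ⟨hu₀.1.of_ker fun i j => ?_, hw⟩
      rw [← firstOcc_eq_iff u₀, ← firstOcc_eq_iff w, hw]
    have h2' : (r : ℝ) * ((r - k : ℕ) : ℝ) ^ k ≤
        (#{w ∈ ({w | IsEvenClosed w} : Finset (Fin (2 * s + 1) → Fin r)) |
          firstOcc w = firstOcc u₀} : ℝ) := by exact_mod_cast h2
    have hdk : (d : ℝ) ≤ K ^ 2 * (r - k : ℕ) := by
      refine hr.trans ?_
      gcongr
    calc _ ≤ (r : ℝ) * ((Fintype.card V * d ^ k) * K ^ (2 * s - 2 * k)) := by gcongr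
      _ ≤ (r : ℝ) * ((Fintype.card V * (K ^ 2 * (r - k : ℕ)) ^ k) * K ^ (2 * s - 2 * k)) := by
          gcongr
      _ = Fintype.card V * (K ^ (2 * k) * K ^ (2 * s - 2 * k)) * (r * ((r - k : ℕ) : ℝ) ^ k) := by
          rw [mul_pow, ← pow_mul]; ring
      _ = Fintype.card V * K ^ (2 * s) * (r * ((r - k : ℕ) : ℝ) ^ k) := by
          rw [← pow_add]; congr 3; omega
      _ ≤ _ := by gcongr
  · have : ({u ∈ S | firstOcc u = p} : Finset _) = ∅ := by
      refine Finset.filter_eq_empty_iff.2 fun u hu h => hp ⟨u, hu, h⟩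
    rw [this, Finset.sum_empty, mul_zero]
    positivity

end Walks

/-! ### Moments of truncated symmetric variables -/

section Truncation

variable {𝕜 : Type*} [RCLike 𝕜]

/-- Truncation of a scalar at modulus `K`. -/
noncomputable def truncVal (K : ℝ) (z : 𝕜) : 𝕜 := if ‖z‖ ≤ K then z else 0

theorem truncVal_zero (K : ℝ) : truncVal K (0 : 𝕜) = 0 := by simp [truncVal]

theorem truncVal_neg (K : ℝ) (z : 𝕜) : truncVal K (-z) = -truncVal K z := by
  by_cases h : ‖z‖ ≤ K <;> simp [truncVal, h]

theorem truncVal_star (K : ℝ) (z : 𝕜) : truncVal K (star z) = star (truncVal K z) := by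
  by_cases h : ‖z‖ ≤ K <;> simp [truncVal, h]

theorem norm_truncVal_le {K : ℝ} (hK : 0 ≤ K) (z : 𝕜) : ‖truncVal K z‖ ≤ K := by
  by_cases h : ‖z‖ ≤ K <;> simp [truncVal, h, hK]

theorem norm_truncVal_le_norm (K : ℝ) (z : 𝕜) : ‖truncVal K z‖ ≤ ‖z‖ := by
  by_cases h : ‖z‖ ≤ K <;> simp [truncVal, h]

theorem measurable_truncVal (K : ℝ) : Measurable (truncVal K : 𝕜 → 𝕜) :=
  Measurable.ite (measurableSet_le measurable_norm measurable_const) measurable_id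
    measurable_const

variable {Ω : Type*} [MeasurableSpace Ω] {P : Measure Ω} {ι : Type*}

/-- The product is an odd function of a symmetric variable. Integrability is not needed, the
integral being zero by convention without it. -/
theorem integral_prod_eq_zero_of_odd {Z : Ω → 𝕜} (hZ : IdentDistrib Z (fun ω => -Z ω) P P)
    {φ : ι → 𝕜 → 𝕜} (hφ : ∀ i, Measurable (φ i)) (hneg : ∀ i z, φ i (-z) = -φ i z)
    {t : Finset ι} (ht : Odd t.card) : ∫ ω, ∏ i ∈ t, φ i (Z ω) ∂P = 0 := by
  have hm : Measurable fun z => ∏ i ∈ t, φ i z := Finset.measurable_fun_prod t fun i _ => hφ i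
  have h := (hZ.comp hm).integral_eq
  have h2 : ∀ z, ∏ i ∈ t, φ i (-z) = -∏ i ∈ t, φ i z := fun z => by
    simp only [hneg]
    rw [Finset.prod_neg, ht.neg_one_pow, neg_one_mul]
  simp only [Function.comp_def, h2, integral_neg] at h
  exact self_eq_neg.1 h

theorem integral_prod_eq_zero_of_ae_zero {Z : Ω → 𝕜} (hZ : ∀ᵐ ω ∂P, Z ω = 0)
    {φ : ι → 𝕜 → 𝕜} (h0 : ∀ i, φ i 0 = 0) {t : Finset ι} (ht : t.Nonempty) :
    ∫ ω, ∏ i ∈ t, φ i (Z ω) ∂P = 0 := by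
  obtain ⟨i, hi⟩ := ht
  rw [integral_congr_ae (g := fun _ => (0 : 𝕜))]
  · simp
  · filter_upwards [hZ] with ω hω
    exact Finset.prod_eq_zero hi (by rw [hω, h0])

theorem integral_norm_sq_of_symm {Z : Ω → 𝕜} (hZ : IdentDistrib Z (fun ω => -Z ω) P P)
    (hvar : ∫ ω, ‖Z ω - ∫ ω', Z ω' ∂P‖ ^ 2 ∂P = 1) :
    Integrable (fun ω => ‖Z ω‖ ^ 2) P ∧ ∫ ω, ‖Z ω‖ ^ 2 ∂P = 1 := by
  have h0 : ∫ ω', Z ω' ∂P = 0 := by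
    have h := hZ.integral_eq
    rw [integral_neg] at h
    exact self_eq_neg.1 h
  simp only [h0, sub_zero] at hvar
  refine ⟨?_, hvar⟩
  -- The integral of a nonintegrable function is zero by convention, so the value one forces
  -- integrability.
  by_contra h
  rw [integral_undef h] at hvar
  exact zero_ne_one hvar

theorem norm_integral_prod_le {K : ℝ} (hK : 0 ≤ K) {Z : Ω → 𝕜}
    (hint : Integrable (fun ω => ‖Z ω‖ ^ 2) P) (h1 : ∫ ω, ‖Z ω‖ ^ 2 ∂P = 1)
    {φ : ι → 𝕜 → 𝕜} (hnorm : ∀ i z, ‖φ i z‖ = ‖truncVal K z‖) {t : Finset ι}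
    (ht : 2 ≤ t.card) : ‖∫ ω, ∏ i ∈ t, φ i (Z ω) ∂P‖ ≤ K ^ (t.card - 2) := by
  have h2 : ∀ ω, ‖∏ i ∈ t, φ i (Z ω)‖ ≤ K ^ (t.card - 2) * ‖Z ω‖ ^ 2 := by
    intro ω
    rw [norm_prod]
    simp only [hnorm]
    rw [Finset.prod_const]
    obtain ⟨k, hk⟩ := Nat.exists_eq_add_of_le ht
    rw [hk, Nat.add_sub_cancel_left, add_comm, pow_add]
    gcongr
    · exact norm_truncVal_le hK _
    · exact norm_truncVal_le_norm _ _
  calc _ ≤ ∫ ω, K ^ (t.card - 2) * ‖Z ω‖ ^ 2 ∂P :=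
        norm_integral_le_of_norm_le (hint.const_mul _) (Eventually.of_forall h2)
    _ = _ := by rw [integral_const_mul, h1, mul_one]

end Truncation

/-! ### Trace moments of the truncated matrix as sums over walks -/

section TraceMoments

open Finset

variable {𝕜 : Type*} [RCLike 𝕜] {Ω : Type*} [MeasurableSpace Ω] {P : Measure Ω} {N : ℕ}
  {A : Ω → Matrix (Fin N) (Fin N) 𝕜}

/-- The entry of a Hermitian matrix on or above the diagonal at an unordered pair. -/
noncomputable def upperEntry (A : Ω → Matrix (Fin N) (Fin N) 𝕜) (e : Sym2 (Fin N)) (ω : Ω) : 𝕜 :=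
  A ω e.inf e.sup

/-- The truncated entry at `(x, y)` in terms of the entry at the unordered pair. -/
noncomputable def truncEntry (K : ℝ) (x y : Fin N) (z : 𝕜) : 𝕜 :=
  if x ≤ y then truncVal K z else star (truncVal K z)

theorem truncateEntries_apply_eq {Ω : Type*} {A : Ω → Matrix (Fin N) (Fin N) 𝕜} {ω : Ω}
    (h : (A ω).IsHermitian) (K : ℝ) (x y : Fin N) :
    truncateEntries K (A ω) x y = truncEntry K x y (upperEntry A s(x, y) ω) := by
  change truncVal K (A ω x y) = _
  by_cases hxy : x ≤ y
  · simp [truncEntry, upperEntry, hxy]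
  · have : y ≤ x := (not_le.1 hxy).le
    simp only [truncEntry, upperEntry, hxy, Sym2.inf_mk, Sym2.sup_mk, if_false, inf_eq_right.2 this,
      sup_eq_left.2 this]
    rw [← truncVal_star, h.apply]

theorem measurable_truncEntry (K : ℝ) (x y : Fin N) :
    Measurable (truncEntry K x y : 𝕜 → 𝕜) := by
  unfold truncEntry
  split_ifs
  · exact measurable_truncVal K
  · exact continuous_star.measurable.comp (measurable_truncVal K)

theorem truncEntry_neg (K : ℝ) (x y : Fin N) (z : 𝕜) :
    truncEntry K x y (-z) = -truncEntry K x y z := by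
  unfold truncEntry
  split_ifs <;> simp [truncVal_neg]

theorem truncEntry_zero (K : ℝ) (x y : Fin N) : truncEntry K x y (0 : 𝕜) = 0 := by
  unfold truncEntry
  split_ifs <;> simp [truncVal_zero]

theorem norm_truncEntry (K : ℝ) (x y : Fin N) (z : 𝕜) :
    ‖truncEntry K x y z‖ = ‖truncVal K z‖ := by
  unfold truncEntry
  split_ifs <;> simp

theorem mem_nonzeroEntries_iff (hA : ∀ ω, (A ω).IsHermitian) (x y : Fin N) :
    (x, y) ∈ nonzeroEntries P A ↔
      ((s(x, y) : Sym2 (Fin N)).inf, (s(x, y) : Sym2 (Fin N)).sup) ∈ nonzeroEntries P A := by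
  by_cases hxy : x ≤ y
  · simp [hxy]
  · have h : y ≤ x := (not_le.1 hxy).le
    have h2 : ∀ ω, A ω x y = 0 ↔ A ω y x = 0 := fun ω => by
      rw [← (hA ω).apply x y, star_eq_zero]
    simp [h, nonzeroEntries, h2]

/-- Both orientations of an edge are odd functions of the same upper entry, so the expectation
factors over unordered pairs. An odd multiplicity or an entry outside `B(N)` gives a zero factor;
otherwise the exponents `m - 2` add up to `n - 2 * edgeCount u`. -/
theorem norm_integral_walk_le [IsProbabilityMeasure P]
    (hmeas : ∀ i j, Measurable fun ω => A ω i j) (hA : ∀ ω, (A ω).IsHermitian)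
    (hindep : iIndepFun (fun (p : {p : Fin N × Fin N // p.1 ≤ p.2}) (ω : Ω) => A ω p.1.1 p.1.2) P)
    (hsymm : ∀ i j, (i, j) ∈ nonzeroEntries P A →
      IdentDistrib (fun ω => A ω i j) (fun ω => -A ω i j) P P)
    (hvar : ∀ i j, (i, j) ∈ nonzeroEntries P A →
      ∫ ω, ‖A ω i j - ∫ ω', A ω' i j ∂P‖ ^ 2 ∂P = 1)
    {K : ℝ} (hK : 0 ≤ K) {n : ℕ} (u : Fin (n + 1) → Fin N) (hu : u 0 = u (Fin.last n)) :
    ‖∫ ω, ∏ i : Fin n, truncateEntries K (A ω) (u i.castSucc) (u i.succ) ∂P‖ ≤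
      open Classical in
      if IsEvenClosed u ∧ ∀ i : Fin n, (u i.castSucc, u i.succ) ∈ nonzeroEntries P A then
        K ^ (n - 2 * edgeCount u) else 0 := by
  classical
  set φ : Fin n → 𝕜 → 𝕜 := fun i => truncEntry K (u i.castSucc) (u i.succ) with hφ
  set F : Sym2 (Fin N) → Finset (Fin n) := fun e => {i | walkEdge u i = e} with hF
  have hprod : ∀ ω, ∏ i : Fin n, truncateEntries K (A ω) (u i.castSucc) (u i.succ) =
      ∏ e, ∏ i ∈ F e, φ i (upperEntry A e ω) := by
    intro ω
    rw [← Finset.prod_fiberwise univ (walkEdge u)]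
    refine Finset.prod_congr rfl fun e _ => Finset.prod_congr rfl fun i hi => ?_
    rw [truncateEntries_apply_eq (hA ω), ← (Finset.mem_filter.1 hi).2]
    rfl
  have hmeasU : ∀ e, Measurable (upperEntry A e) := fun e => hmeas _ _
  have hindepU : iIndepFun (fun e => upperEntry A e) P := by
    have := hindep.precomp (g := (Sym2.sortEquiv : Sym2 (Fin N) ≃ _)) (Equiv.injective _)
    exact this
  have hmeasφ : ∀ i, Measurable (φ i) := fun i => measurable_truncEntry _ _ _
  simp only [hprod]
  rw [hindepU.integral_fun_prod_comp (f := fun e z => ∏ i ∈ F e, φ i z)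
    (fun e => (hmeasU e).aemeasurable)
    (fun e => (Finset.measurable_fun_prod _ fun i _ => hmeasφ i).aestronglyMeasurable), norm_prod]
  have hzero : ∀ e, (∃ j, walkEdge u j = e) → (e.inf, e.sup) ∉ nonzeroEntries P A →
      ∫ ω, ∏ i ∈ F e, φ i (upperEntry A e ω) ∂P = 0 := by
    rintro e ⟨j, hj⟩ he
    refine integral_prod_eq_zero_of_ae_zero (not_not.1 he)
      (fun i => truncEntry_zero _ _ _) ⟨j, by simp [hF, hj]⟩
  split_ifs with hcond
  · obtain ⟨heven, hB⟩ := hcond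
    have hbound : ∀ e, ‖∫ ω, ∏ i ∈ F e, φ i (upperEntry A e ω) ∂P‖ ≤
        if e ∈ univ.image (walkEdge u) then K ^ (#(F e) - 2) else 1 := by
      intro e
      split_ifs with he
      · obtain ⟨j, -, rfl⟩ := Finset.mem_image.1 he
        have hmem := (mem_nonzeroEntries_iff hA _ _).1 (hB j)
        obtain ⟨h1, h2⟩ := integral_norm_sq_of_symm (hsymm _ _ hmem) (hvar _ _ hmem)
        refine norm_integral_prod_le hK h1 h2 (fun i z => norm_truncEntry _ _ _ _) ?_
        have h3 : Even #(F (walkEdge u j)) := by convert heven.2 j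
        have h4 : 0 < #(F (walkEdge u j)) := Finset.card_pos.2 ⟨j, by simp [hF]⟩
        obtain ⟨k, hk⟩ := h3
        omega
      · have : F e = ∅ := by
          refine Finset.filter_eq_empty_iff.2 fun i _ h => he ?_
          exact Finset.mem_image.2 ⟨i, Finset.mem_univ _, h⟩
        simp [this]
    refine (Finset.prod_le_prod (fun _ _ => norm_nonneg _) fun e _ => hbound e).trans ?_
    rw [Finset.prod_ite_mem, Finset.univ_inter, Finset.prod_pow_eq_pow_sum]
    refine (congrArg (K ^ ·) ?_).le
    have hcard : ∑ e ∈ univ.image (walkEdge u), #(F e) = n := by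
      rw [← Finset.card_eq_sum_card_image, Finset.card_univ, Fintype.card_fin]
    have h2 : ∑ e ∈ univ.image (walkEdge u), (#(F e) - 2) + ∑ _e ∈ univ.image (walkEdge u), 2 =
        ∑ e ∈ univ.image (walkEdge u), #(F e) := by
      rw [← Finset.sum_add_distrib]
      refine Finset.sum_congr rfl fun e he => ?_
      obtain ⟨j, -, rfl⟩ := Finset.mem_image.1 he
      have h3 : Even #(F (walkEdge u j)) := by convert heven.2 j
      have h4 : 0 < #(F (walkEdge u j)) := Finset.card_pos.2 ⟨j, by simp [hF]⟩
      obtain ⟨k, hk⟩ := h3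
      omega
    rw [hcard, Finset.sum_const, smul_eq_mul] at h2
    have h5 : edgeCount u = #(univ.image (walkEdge u)) := by unfold edgeCount; congr!
    change _ = _
    omega
  · by_cases hB : ∀ i : Fin n, (u i.castSucc, u i.succ) ∈ nonzeroEntries P A
    · have : ∃ j, ¬ Even (#(F (walkEdge u j))) := by
        by_contra h
        push Not at h
        refine hcond ⟨⟨hu, fun j => ?_⟩, hB⟩
        convert h j
      obtain ⟨j, hj⟩ := this
      have hmem := (mem_nonzeroEntries_iff hA _ _).1 (hB j)
      refine (Finset.prod_eq_zero (Finset.mem_univ (walkEdge u j)) ?_).le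
      rw [norm_eq_zero]
      exact integral_prod_eq_zero_of_odd (hsymm _ _ hmem) hmeasφ
        (fun i z => truncEntry_neg _ _ _ _) (Nat.not_even_iff_odd.1 hj)
    · push Not at hB
      obtain ⟨j, hj⟩ := hB
      refine (Finset.prod_eq_zero (Finset.mem_univ (walkEdge u j)) ?_).le
      rw [norm_eq_zero]
      exact hzero _ ⟨j, rfl⟩ fun h => hj ((mem_nonzeroEntries_iff hA _ _).2 h)

theorem integrable_prod_truncateEntries [IsProbabilityMeasure P]
    (hmeas : ∀ i j, Measurable fun ω => A ω i j) {K : ℝ} (hK : 0 ≤ K) {n : ℕ}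
    (u : Fin (n + 1) → Fin N) : Integrable
      (fun ω => ∏ i : Fin n, truncateEntries K (A ω) (u i.castSucc) (u i.succ)) P := by
  refine Integrable.of_bound (C := K ^ n) ?_ (Eventually.of_forall fun ω => ?_)
  · exact (Finset.measurable_fun_prod _ fun i _ =>
      (measurable_truncVal K).comp (hmeas _ _)).aestronglyMeasurable
  · rw [norm_prod]
    calc _ ≤ ∏ _i : Fin n, K :=
          Finset.prod_le_prod (fun _ _ => norm_nonneg _) fun i _ => norm_truncVal_le hK _
      _ = _ := by simp

theorem integrable_trace_truncateEntries_pow [IsProbabilityMeasure P]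
    (hmeas : ∀ i j, Measurable fun ω => A ω i j) {K : ℝ} (hK : 0 ≤ K) (n : ℕ) :
    Integrable (fun ω => (truncateEntries K (A ω) ^ n).trace) P := by
  simp only [Matrix.trace_pow_eq_sum_walks]
  exact integrable_finsetSum _ fun u _ => integrable_prod_truncateEntries hmeas hK u

open Classical in
theorem integral_trace_pow_le [IsProbabilityMeasure P]
    (hmeas : ∀ i j, Measurable fun ω => A ω i j) (hA : ∀ ω, (A ω).IsHermitian)
    (hindep : iIndepFun (fun (p : {p : Fin N × Fin N // p.1 ≤ p.2}) (ω : Ω) => A ω p.1.1 p.1.2) P)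
    (hsymm : ∀ i j, (i, j) ∈ nonzeroEntries P A →
      IdentDistrib (fun ω => A ω i j) (fun ω => -A ω i j) P P)
    (hvar : ∀ i j, (i, j) ∈ nonzeroEntries P A →
      ∫ ω, ‖A ω i j - ∫ ω', A ω' i j ∂P‖ ^ 2 ∂P = 1)
    {K : ℝ} (hK : 0 ≤ K) (n : ℕ) :
    ∫ ω, RCLike.re (truncateEntries K (A ω) ^ n).trace ∂P ≤
      ∑ u : Fin (n + 1) → Fin N with IsEvenClosed u ∧
        ∀ i : Fin n, (u i.castSucc, u i.succ) ∈ nonzeroEntries P A,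
          K ^ (n - 2 * edgeCount u) := by
  rw [integral_re (integrable_trace_truncateEntries_pow hmeas hK n)]
  refine (RCLike.re_le_norm _).trans ?_
  simp only [Matrix.trace_pow_eq_sum_walks]
  rw [integral_finsetSum _ fun u _ => integrable_prod_truncateEntries hmeas hK u]
  refine (norm_sum_le _ _).trans ?_
  refine (Finset.sum_le_sum fun u hu => norm_integral_walk_le hmeas hA hindep hsymm hvar hK u
    (Finset.mem_filter.1 hu).2).trans ?_
  rw [← Finset.sum_filter]
  refine Finset.sum_le_sum_of_subset_of_nonneg ?_ fun u _ _ => by positivity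
  intro u hu
  rw [Finset.mem_filter] at hu ⊢
  exact ⟨Finset.mem_univ _, hu.2⟩

end TraceMoments

/-! ### Operator norm and trace -/

section OperatorNorm

open scoped Matrix.Norms.L2Operator

variable {𝕜 : Type*} [RCLike 𝕜] {N : ℕ}

theorem l2OpNorm_pow_le_trace {M : Matrix (Fin N) (Fin N) 𝕜} (hM : M.IsHermitian) {s : ℕ}
    (hs : 1 ≤ s) : l2OpNorm M ^ (2 * s) ≤ RCLike.re (M ^ (2 * s)).trace := by
  have hl : l2OpNorm M = ‖M‖ := rfl
  have htr : RCLike.re (M ^ (2 * s)).trace = ∑ i, hM.eigenvalues i ^ (2 * s) := by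
    conv_lhs => rw [hM.spectral_theorem]
    rw [← map_pow, Unitary.conjStarAlgAut_apply, Matrix.trace_mul_cycle, Unitary.coe_star_mul_self,
      one_mul, Matrix.diagonal_pow, Matrix.trace_diagonal, map_sum]
    refine Finset.sum_congr rfl fun i _ => ?_
    rw [Pi.pow_apply, Function.comp_apply, ← RCLike.ofReal_pow, RCLike.ofReal_re]
  have hnorm : ‖M‖ = ‖(RCLike.ofReal ∘ hM.eigenvalues : Fin N → 𝕜)‖ := by
    rw [← Matrix.l2_opNorm_diagonal]
    conv_lhs => rw [hM.spectral_theorem]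
    rw [Unitary.conjStarAlgAut_apply, ← Unitary.coe_star, CStarRing.norm_mul_coe_unitary,
      CStarRing.norm_coe_unitary_mul]
  have hnn : ∀ i, 0 ≤ hM.eigenvalues i ^ (2 * s) := fun i => (even_two_mul s).pow_nonneg _
  rw [hl, htr, hnorm]
  rcases isEmpty_or_nonempty (Fin N) with h | h
  · have : ‖(RCLike.ofReal ∘ hM.eigenvalues : Fin N → 𝕜)‖ = 0 := by
      rw [norm_eq_zero]; exact Subsingleton.elim _ _
    rw [this, zero_pow (by omega)]
    exact Finset.sum_nonneg fun i _ => hnn i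
  · obtain ⟨i, hi⟩ := Finite.exists_max fun i => |hM.eigenvalues i|
    have h1 : ‖(RCLike.ofReal ∘ hM.eigenvalues : Fin N → 𝕜)‖ ≤ |hM.eigenvalues i| := by
      rw [pi_norm_le_iff_of_nonneg (abs_nonneg _)]
      intro j
      simpa using hi j
    calc _ ≤ |hM.eigenvalues i| ^ (2 * s) := by gcongr
      _ = hM.eigenvalues i ^ (2 * s) := (even_two_mul s).pow_abs _
      _ ≤ _ := Finset.single_le_sum (f := fun i => hM.eigenvalues i ^ (2 * s)) (fun i _ => hnn i)
        (Finset.mem_univ i)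

theorem isHermitian_truncateEntries {M : Matrix (Fin N) (Fin N) 𝕜} (hM : M.IsHermitian) (K : ℝ) :
    (truncateEntries K M).IsHermitian := by
  ext i j
  change star (truncVal K (M j i)) = truncVal K (M i j)
  rw [← truncVal_star, hM.apply]

end OperatorNorm

/-! ### Bounds at fixed `N` -/

section FixedSize

open Finset

open Classical in
theorem card_walks_le {V : Type*} [Fintype V] (B : V → V → Prop) (d : ℕ)
    (hd : ∀ x, #{y | B x y} ≤ d) (n : ℕ) :
    #{u : Fin (n + 1) → V | ∀ i : Fin n, B (u i.castSucc) (u i.succ)} ≤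
      Fintype.card V * d ^ n := by
  replace nb := fun x => (Function.Embedding.nonempty_of_card_le (α := {y // B x y}) (β := Fin d)
    (by rw [Fintype.card_subtype, Fintype.card_fin]; exact hd x)).some
  have hcard : Fintype.card V * d ^ n = Fintype.card (V × (Fin n → Fin d)) := by simp
  rw [hcard, ← Fintype.card_subtype]
  refine Fintype.card_le_of_injective
    (fun u => (u.1 0, fun i => nb (u.1 i.castSucc) ⟨u.1 i.succ, u.2 i⟩)) ?_
  rintro ⟨u, hu⟩ ⟨w, hw⟩ h
  rw [Prod.mk.injEq] at h
  apply Subtype.ext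
  funext i
  induction i using Fin.induction with
  | zero => exact h.1
  | succ i ih =>
    have h2 := congrFun h.2 i
    have h4 : ∀ (x x' : V) (y y' : V) (hy : B x y) (hy' : B x' y'), x = x' →
        nb x ⟨y, hy⟩ = nb x' ⟨y', hy'⟩ → y = y' := by
      rintro x _ y y' hy hy' rfl h
      exact congrArg Subtype.val ((nb x).injective h)
    exact h4 _ _ _ _ _ _ ih h2

variable {𝕜 : Type*} [RCLike 𝕜] {Ω : Type*} [MeasurableSpace Ω] {P : Measure Ω}
  [IsProbabilityMeasure P] {N : ℕ} {A : Ω → Matrix (Fin N) (Fin N) 𝕜}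

open Classical in
theorem card_nonzeroEntries_row {P : Measure Ω} (x : Fin N) :
    #{y | (x, y) ∈ nonzeroEntries P A} = rowCount P A x := by
  rw [rowCount, Set.ncard_eq_toFinset_card']
  congr 1
  ext y
  simp

theorem integral_trace_pow_le_catalan
    (hmeas : ∀ i j, Measurable fun ω => A ω i j) (hA : ∀ ω, (A ω).IsHermitian)
    (hindep : iIndepFun (fun (p : {p : Fin N × Fin N // p.1 ≤ p.2}) (ω : Ω) => A ω p.1.1 p.1.2) P)
    (hsymm : ∀ i j, (i, j) ∈ nonzeroEntries P A →
      IdentDistrib (fun ω => A ω i j) (fun ω => -A ω i j) P P)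
    (hvar : ∀ i j, (i, j) ∈ nonzeroEntries P A →
      ∫ ω, ‖A ω i j - ∫ ω', A ω' i j ∂P‖ ^ 2 ∂P = 1)
    {K : ℝ} (hK : 1 ≤ K) {d r s : ℕ} (hd : ∀ i, rowCount P A i ≤ d) (hs : 1 ≤ s) (hrs : s ≤ r)
    (hdr : (d : ℝ) ≤ K ^ 2 * (r - s : ℕ)) (hsr : 100 * s ^ 5 ≤ r ^ 2) :
    ∫ ω, RCLike.re (truncateEntries K (A ω) ^ (2 * s)).trace ∂P ≤
      3 * N * (K ^ 2 * r) ^ s * catalan s := by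
  classical
  have hr0 : (0 : ℝ) < r := by exact_mod_cast (by omega)
  have h1 := integral_trace_pow_le hmeas hA hindep hsymm hvar (zero_le_one.trans hK) (2 * s)
  have h2 := sum_evenClosed_le (fun x y => (x, y) ∈ nonzeroEntries P A) d
    (fun x => by rw [card_nonzeroEntries_row]; exact hd x) hK hrs hdr
  have h3 := (evenClosedCount_le_goeMoment (Fin r) (2 * s)).trans
    (goeMoment_two_mul_le hs (by simpa using hsr))
  rw [Fintype.card_fin] at h2 h3
  refine le_of_mul_le_mul_left ?_ hr0
  calc _ ≤ _ := mul_le_mul_of_nonneg_left h1 hr0.le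
    _ ≤ _ := h2
    _ ≤ N * K ^ (2 * s) * (3 * (r : ℝ) ^ (s + 1) * catalan s) := by gcongr
    _ = _ := by rw [mul_pow, ← pow_mul]; ring

/-- A crude bound for the regime without the comparison: every walk is counted, with the largest
weight `K ^ n`. -/
theorem integral_trace_pow_le_degree
    (hmeas : ∀ i j, Measurable fun ω => A ω i j) (hA : ∀ ω, (A ω).IsHermitian)
    (hindep : iIndepFun (fun (p : {p : Fin N × Fin N // p.1 ≤ p.2}) (ω : Ω) => A ω p.1.1 p.1.2) P)
    (hsymm : ∀ i j, (i, j) ∈ nonzeroEntries P A →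
      IdentDistrib (fun ω => A ω i j) (fun ω => -A ω i j) P P)
    (hvar : ∀ i j, (i, j) ∈ nonzeroEntries P A →
      ∫ ω, ‖A ω i j - ∫ ω', A ω' i j ∂P‖ ^ 2 ∂P = 1)
    {K : ℝ} (hK : 1 ≤ K) {d : ℕ} (hd : ∀ i, rowCount P A i ≤ d) (n : ℕ) :
    ∫ ω, RCLike.re (truncateEntries K (A ω) ^ n).trace ∂P ≤ N * (d * K) ^ n := by
  classical
  have h1 := integral_trace_pow_le hmeas hA hindep hsymm hvar (zero_le_one.trans hK) n
  refine h1.trans ?_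
  refine (Finset.sum_le_card_nsmul _ _ (K ^ n) fun u _ =>
    pow_le_pow_right₀ hK (Nat.sub_le _ _)).trans ?_
  rw [nsmul_eq_mul, mul_pow, ← mul_assoc]
  gcongr
  have h2 := card_walks_le (fun x y => (x, y) ∈ nonzeroEntries P A) d
    (fun x => by rw [card_nonzeroEntries_row]; exact hd x) n
  rw [Fintype.card_fin] at h2
  norm_cast
  exact (Finset.card_le_card (Finset.monotone_filter_right _ fun u _ hu => hu.2)).trans h2

theorem measure_l2OpNorm_ge_le
    (hmeas : ∀ i j, Measurable fun ω => A ω i j) (hA : ∀ ω, (A ω).IsHermitian)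
    {K : ℝ} (hK : 0 ≤ K) {s : ℕ} (hs : 1 ≤ s) {x : ℝ} (hx : 0 < x) :
    x ^ (2 * s) * P.real {ω | x ≤ l2OpNorm (truncateEntries K (A ω))} ≤
      ∫ ω, RCLike.re (truncateEntries K (A ω) ^ (2 * s)).trace ∂P := by
  have hnorm : ∀ ω, l2OpNorm (truncateEntries K (A ω)) ^ (2 * s) ≤
      RCLike.re (truncateEntries K (A ω) ^ (2 * s)).trace := fun ω =>
    l2OpNorm_pow_le_trace (isHermitian_truncateEntries (hA ω) K) hs
  have h := mul_meas_ge_le_integral_of_nonneg (μ := P)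
    (f := fun ω => RCLike.re (truncateEntries K (A ω) ^ (2 * s)).trace)
    (Eventually.of_forall fun ω => ((even_two_mul s).pow_nonneg _).trans (hnorm ω))
    (integrable_trace_truncateEntries_pow hmeas hK (2 * s)).re (x ^ (2 * s))
  refine le_trans ?_ h
  refine mul_le_mul_of_nonneg_left (measureReal_mono fun ω hω => ?_) (by positivity)
  exact (pow_le_pow_left₀ hx.le hω _).trans (hnorm _)

end FixedSize

/-! ### Choice of the parameters as `N` grows -/

section Asymptotics

theorem slowlyVarying_const {c : ℝ} (hc : 0 < c) : SlowlyVarying fun _ => c :=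
  ⟨measurable_const, Eventually.of_forall fun _ => hc, fun _ _ => by
    simp [div_self hc.ne']⟩

theorem eventually_mul_rpow_le (c : ℝ) {p q : ℝ} (h : p < q) :
    ∀ᶠ N : ℕ in atTop, c * (N : ℝ) ^ p ≤ (N : ℝ) ^ q := by
  have h1 := ((tendsto_rpow_atTop (sub_pos.2 h)).comp tendsto_natCast_atTop_atTop).eventually_ge_atTop c
  filter_upwards [h1, eventually_gt_atTop 0] with N hN hN0
  have hN0 : (0 : ℝ) < N := by exact_mod_cast hN0
  calc c * (N : ℝ) ^ p ≤ (N : ℝ) ^ (q - p) * (N : ℝ) ^ p := by gcongr; exact hN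
    _ = _ := by rw [← Real.rpow_add hN0]; ring_nf

/-- On the boundary, `s ≤ N ^ γ''` turns the bound on `a N - 1` into a relative excess `C / s`. Off
the boundary a power of `N` absorbs `a N`, and `C = 0`. -/
theorem eventually_degree_le {μ γ' γ'' : ℝ} {a : ℕ → ℝ} (ha : Tendsto a atTop (𝓝 1))
    (h1 : μ / 2 ≤ γ')
    (hbd : γ' = μ / 2 → ∃ C : ℝ, ∀ N : ℕ, (a N - 1) * (N : ℝ) ^ γ'' ≤ C) :
    ∃ C : ℝ, 0 ≤ C ∧ ∀ᶠ N : ℕ in atTop, ∀ s : ℕ, 1 ≤ s → (s : ℝ) ≤ (N : ℝ) ^ γ'' →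
      a N * (N : ℝ) ^ μ ≤ (N : ℝ) ^ (2 * γ') * (1 + C / s) := by
  rcases h1.eq_or_lt with h | h
  · obtain ⟨C, hC⟩ := hbd h.symm
    refine ⟨max C 0, le_max_right _ _, Eventually.of_forall fun N s hs hsN => ?_⟩
    have hs0 : (0 : ℝ) < s := by exact_mod_cast hs
    have h2 : 2 * γ' = μ := by linarith
    have h3 : a N - 1 ≤ max C 0 / s := by
      rw [le_div_iff₀ hs0]
      rcases le_total 0 (a N - 1) with h0 | h0
      · calc (a N - 1) * s ≤ (a N - 1) * (N : ℝ) ^ γ'' := by gcongr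
          _ ≤ C := hC N
          _ ≤ _ := le_max_left _ _
      · exact (mul_nonpos_of_nonpos_of_nonneg h0 hs0.le).trans (le_max_right _ _)
    rw [h2, mul_comm]
    gcongr
    linarith
  · refine ⟨0, le_rfl, ?_⟩
    filter_upwards [ha.eventually_le_const (show (1 : ℝ) < 2 by norm_num),
      eventually_mul_rpow_le 2 (show μ < 2 * γ' by linarith)] with N hN hN2 s _ _
    rw [zero_div, add_zero, mul_one]
    exact le_trans (by gcongr) hN2

theorem exists_comparison_size {γ γ' γ'' : ℝ} (h2 : γ + γ'' < γ')
    (hgap : 5 * γ'' < 4 * (γ' - γ)) :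
    ∀ᶠ N : ℕ in atTop, ∀ s : ℕ, 1 ≤ s → (s : ℝ) ≤ (N : ℝ) ^ γ'' → ∀ d C : ℝ, 0 ≤ C →
      d ≤ (N : ℝ) ^ (2 * γ') * (1 + C / s) →
      ∃ r : ℕ, s ≤ r ∧ d ≤ ((N : ℝ) ^ γ) ^ 2 * (r - s : ℕ) ∧ 100 * s ^ 5 ≤ r ^ 2 ∧
        (((N : ℝ) ^ γ) ^ 2 * r) ^ s ≤ Real.exp (C + 2) * ((N : ℝ) ^ γ') ^ (2 * s) := by
  filter_upwards [eventually_mul_rpow_le 100 hgap, eventually_ge_atTop 1] with N hN hN1 s hs hsN d C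
    hC hd
  have hN1' : (1 : ℝ) ≤ N := by exact_mod_cast hN1
  have hN0 : (0 : ℝ) < N := by linarith
  have hs0 : (0 : ℝ) < s := by exact_mod_cast hs
  have hs1 : (1 : ℝ) ≤ s := by exact_mod_cast hs
  set K : ℝ := (N : ℝ) ^ γ with hK
  have hK0 : 0 < K := by positivity
  have hD : (N : ℝ) ^ (2 * γ') = ((N : ℝ) ^ γ') ^ 2 := by
    rw [← Real.rpow_mul_natCast hN0.le]; ring_nf
  set D : ℝ := (N : ℝ) ^ (2 * γ') with hDdef
  have hD0 : 0 < D := by positivity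
  have hCs : 0 ≤ C / s := by positivity
  set q : ℝ := D * (1 + C / s) / K ^ 2 with hq
  have hq0 : 0 ≤ q := by positivity
  -- `q` is the value of `r - s` required by the degree condition.
  refine ⟨s + ⌈q⌉₊, by omega, ?_, ?_, ?_⟩
  · rw [Nat.add_sub_cancel_left]
    calc d ≤ D * (1 + C / s) := hd
      _ = K ^ 2 * q := by rw [hq]; field_simp
      _ ≤ _ := by gcongr; exact Nat.le_ceil q
  · have h3 : (N : ℝ) ^ (2 * (γ' - γ)) ≤ ((s + ⌈q⌉₊ : ℕ) : ℝ) := by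
      have : (N : ℝ) ^ (2 * (γ' - γ)) = D / K ^ 2 := by
        rw [hDdef, hK, ← Real.rpow_mul_natCast hN0.le, ← Real.rpow_sub hN0]
        push_cast; ring_nf
      rw [this]
      push_cast
      have h4 : D / K ^ 2 ≤ q := by
        rw [hq]
        gcongr
        nlinarith
      have := Nat.le_ceil q
      linarith
    have h5 : 100 * (s : ℝ) ^ 5 ≤ ((s + ⌈q⌉₊ : ℕ) : ℝ) ^ 2 := by
      calc 100 * (s : ℝ) ^ 5 ≤ 100 * ((N : ℝ) ^ γ'') ^ 5 := by gcongr
        _ = 100 * (N : ℝ) ^ (5 * γ'') := by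
          rw [← Real.rpow_mul_natCast hN0.le]; push_cast; ring_nf
        _ ≤ (N : ℝ) ^ (4 * (γ' - γ)) := hN
        _ = ((N : ℝ) ^ (2 * (γ' - γ))) ^ 2 := by
          rw [← Real.rpow_mul_natCast hN0.le]; push_cast; ring_nf
        _ ≤ _ := by gcongr
    exact_mod_cast h5
  · have h6 : K ^ 2 * (s + 1) ≤ D * (2 / s) := by
      have h7 : K ^ 2 * s ^ 2 ≤ D := by
        calc K ^ 2 * (s : ℝ) ^ 2 ≤ K ^ 2 * ((N : ℝ) ^ γ'') ^ 2 := by gcongr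
          _ = (N : ℝ) ^ (2 * (γ + γ'')) := by
            rw [hK, ← mul_pow, ← Real.rpow_add hN0, ← Real.rpow_mul_natCast hN0.le]
            push_cast; ring_nf
          _ ≤ _ := Real.rpow_le_rpow_of_exponent_le hN1' (by linarith)
      rw [mul_div_assoc', le_div_iff₀ hs0]
      have : K ^ 2 * (s + 1) * s ≤ K ^ 2 * (s + s) * s := by gcongr
      nlinarith
    have h8 : K ^ 2 * ((s + ⌈q⌉₊ : ℕ) : ℝ) ≤ D * (1 + (C + 2) / s) := by
      have h9 : ((s + ⌈q⌉₊ : ℕ) : ℝ) ≤ q + (s + 1) := by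
        push_cast
        have := (Nat.ceil_lt_add_one hq0).le
        linarith
      calc _ ≤ K ^ 2 * (q + (s + 1)) := by gcongr
        _ = D * (1 + C / s) + K ^ 2 * (s + 1) := by rw [hq]; field_simp
        _ ≤ D * (1 + C / s) + D * (2 / s) := by gcongr
        _ = _ := by ring
    calc _ ≤ (D * (1 + (C + 2) / s)) ^ s := by gcongr
      _ = (1 + (C + 2) / s) ^ s * D ^ s := by rw [mul_pow, mul_comm]
      _ ≤ (Real.exp ((C + 2) / s)) ^ s * D ^ s := by
          gcongr
          rw [add_comm]; exact Real.add_one_le_exp _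
      _ = Real.exp (C + 2) * ((N : ℝ) ^ γ') ^ (2 * s) := by
          rw [← Real.exp_nat_mul, hD, ← pow_mul]
          congr 2
          field_simp

end Asymptotics

/-! ### Assembly of the final estimates -/

theorem eventually_integral_trace_pow_le {𝕜 : Type*} [RCLike 𝕜] {Ω : ℕ → Type*}
    [∀ N, MeasurableSpace (Ω N)]
    (P : ∀ N, Measure (Ω N)) [∀ N, IsProbabilityMeasure (P N)]
    (A : ∀ N, Ω N → Matrix (Fin N) (Fin N) 𝕜)
    (μ α : ℝ) (hμ : 0 < μ) (a : ℕ → ℝ) (L : ℝ → ℝ)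
    (hA : IsSparseHeavyTailed P A μ α a L)
    (hsymm : ∀ N (i j : Fin N), (i, j) ∈ nonzeroEntries (P N) (A N) →
      IdentDistrib (fun ω => A N ω i j) (fun ω => -A N ω i j) (P N) (P N))
    (hvar : ∀ N (i j : Fin N), (i, j) ∈ nonzeroEntries (P N) (A N) →
      ∫ ω, ‖A N ω i j - ∫ ω', A N ω' i j ∂(P N)‖ ^ 2 ∂(P N) = 1)
    (γ γ' γ'' : ℝ) (hγ : 0 < γ)
    (h1 : μ / 2 ≤ γ') (h2 : μ / 4 + γ + γ'' < γ')
    (hbd : γ' = μ / 2 → ∃ C : ℝ, ∀ N : ℕ, (a N - 1) * (N : ℝ) ^ γ'' ≤ C) :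
    ∃ C : ℝ, 0 ≤ C ∧ ∀ᶠ N : ℕ in atTop, ∀ s : ℕ, 1 ≤ s → (s : ℝ) ≤ (N : ℝ) ^ γ'' →
      ∫ ω, RCLike.re (truncateEntries ((N : ℝ) ^ γ) (A N ω) ^ (2 * s)).trace ∂(P N) ≤
        C * ((N : ℝ) ^ (1 + 2 * γ) * (s : ℝ) ^ (-(3 / 2) : ℝ) * (2 * (N : ℝ) ^ γ') ^ (2 * s)) := by
  have hrow : ∀ N : ℕ, 1 ≤ N → 0 ≤ a N * (N : ℝ) ^ μ ∧
      ∀ i, rowCount (P N) (A N) i ≤ ⌊a N * (N : ℝ) ^ μ⌋₊ := by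
    intro N hN
    have hN0 : (0 : ℝ) < (N : ℝ) ^ μ := Real.rpow_pos_of_pos (by exact_mod_cast hN) _
    have h3 : ∀ i, (rowCount (P N) (A N) i : ℝ) ≤ a N * (N : ℝ) ^ μ := fun i => by
      have := hA.row_le N i
      rwa [div_le_iff₀ hN0] at this
    exact ⟨(Nat.cast_nonneg _).trans (h3 ⟨0, hN⟩), fun i => Nat.le_floor (h3 i)⟩
  have hpow : ∀ N : ℕ, 1 ≤ N → (N : ℝ) ≤ (N : ℝ) ^ (1 + 2 * γ) := by
    intro N hN
    conv_lhs => rw [← Real.rpow_one (N : ℝ)]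
    exact Real.rpow_le_rpow_of_exponent_le (by exact_mod_cast hN) (by linarith)
  rcases lt_or_ge (5 * γ'') (4 * (γ' - γ)) with hgap | hgap
  · obtain ⟨C, hC0, hC⟩ := eventually_degree_le hA.tendsto_a h1 hbd
    refine ⟨3 * Real.exp (C + 2), by positivity, ?_⟩
    filter_upwards [hC, exists_comparison_size (by linarith : γ + γ'' < γ') hgap,
      eventually_ge_atTop 1] with N hN hN2 hN1 s hs hsN
    obtain ⟨h0, hd⟩ := hrow N hN1
    obtain ⟨r, hsr, hdr, hr, hrD⟩ := hN2 s hs hsN _ C hC0 (hN s hs hsN)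
    have hK : 1 ≤ (N : ℝ) ^ γ := Real.one_le_rpow (by exact_mod_cast hN1) hγ.le
    calc _ ≤ 3 * N * (((N : ℝ) ^ γ) ^ 2 * r) ^ s * catalan s :=
          integral_trace_pow_le_catalan (hA.measurable N) (hA.hermitian N) (hA.indep N) (hsymm N)
            (hvar N) hK hd hs hsr ((Nat.floor_le h0).trans hdr) hr
      _ ≤ 3 * (N : ℝ) ^ (1 + 2 * γ) * (Real.exp (C + 2) * ((N : ℝ) ^ γ') ^ (2 * s)) *
          (4 ^ s * (s : ℝ) ^ (-(3 / 2) : ℝ)) := by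
          gcongr
          · exact hpow N hN1
          · exact catalan_le_rpow hs
      _ = _ := by
          rw [mul_pow, pow_mul (2 : ℝ)]
          norm_num
          ring
  -- Together, 4(γ'-γ) ≤ 5γ'' and γ'' < γ'-γ-μ/4 give γ'-γ > 5μ/4, so the crude base dK is below
  -- N^γ'.
  · refine ⟨1, zero_le_one, ?_⟩
    filter_upwards [hA.tendsto_a.eventually_le_const (show (1 : ℝ) < 2 by norm_num),
      eventually_mul_rpow_le 2 (show μ + γ < γ' by linarith),
      eventually_ge_atTop 1] with N hN hN2 hN1 s hs hsN
    obtain ⟨h0, hd⟩ := hrow N hN1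
    have hN0 : (0 : ℝ) < N := by exact_mod_cast hN1
    have hK : 1 ≤ (N : ℝ) ^ γ := Real.one_le_rpow (by exact_mod_cast hN1) hγ.le
    have h3 : (⌊a N * (N : ℝ) ^ μ⌋₊ : ℝ) * (N : ℝ) ^ γ ≤ (N : ℝ) ^ γ' := by
      calc _ ≤ (2 * (N : ℝ) ^ μ) * (N : ℝ) ^ γ := by
            gcongr
            exact (Nat.floor_le h0).trans (by gcongr)
        _ = 2 * (N : ℝ) ^ (μ + γ) := by rw [Real.rpow_add hN0]; ring
        _ ≤ _ := hN2
    -- The factor missing from the crude bound dominates a Catalan number, hence is at least one.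
    have h4 : (1 : ℝ) ≤ 4 ^ s * (s : ℝ) ^ (-(3 / 2) : ℝ) := by
      refine le_trans ?_ (catalan_le_rpow hs)
      exact_mod_cast catalan_pos s
    calc _ ≤ (N : ℝ) * (⌊a N * (N : ℝ) ^ μ⌋₊ * (N : ℝ) ^ γ) ^ (2 * s) :=
          integral_trace_pow_le_degree (hA.measurable N) (hA.hermitian N) (hA.indep N) (hsymm N)
            (hvar N) hK hd (2 * s)
      _ ≤ (N : ℝ) ^ (1 + 2 * γ) * ((N : ℝ) ^ γ') ^ (2 * s) * 1 := by
          rw [mul_one]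
          gcongr
          exact hpow N hN1
      _ ≤ (N : ℝ) ^ (1 + 2 * γ) * ((N : ℝ) ^ γ') ^ (2 * s)
          * (4 ^ s * (s : ℝ) ^ (-(3 / 2) : ℝ)) := by gcongr
      _ = _ := by
          rw [mul_pow, pow_mul (2 : ℝ)]
          norm_num
          ring

/-- Below the threshold only finitely many pairs satisfy `s ≤ N ^ γ''`; a larger constant covers
them. -/
theorem exists_bound_of_eventually {γ'' : ℝ} (hγ'' : 0 < γ'') (E R : ℕ → ℕ → ℝ)
    (hR : ∀ N s, 1 ≤ N → 1 ≤ s → 0 < R N s) {C : ℝ} (hC : 0 ≤ C)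
    (h : ∀ᶠ N : ℕ in atTop, ∀ s : ℕ, 1 ≤ s → (s : ℝ) ≤ (N : ℝ) ^ γ'' → E N s ≤ C * R N s) :
    ∃ C' : ℝ, 0 < C' ∧ ∀ N s : ℕ, 1 ≤ N → 1 ≤ s → (s : ℝ) ≤ (N : ℝ) ^ γ'' →
      E N s ≤ C' * R N s := by
  obtain ⟨N₀, hN₀⟩ := eventually_atTop.1 h
  set T : Finset (ℕ × ℕ) := Finset.range N₀ ×ˢ Finset.range (⌊(N₀ : ℝ) ^ γ''⌋₊ + 1) with hT
  set Q : ℝ := ∑ p ∈ T, |E p.1 p.2 / R p.1 p.2| with hQ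
  have hQ0 : 0 ≤ Q := Finset.sum_nonneg fun _ _ => abs_nonneg _
  refine ⟨C + Q + 1, by linarith, fun N s hN hs hsN => ?_⟩
  have hRpos := hR N s hN hs
  rcases le_or_gt N₀ N with hle | hlt
  · refine (hN₀ N hle s hs hsN).trans ?_
    gcongr
    linarith
  · have hmem : (N, s) ∈ T := by
      rw [hT, Finset.mem_product, Finset.mem_range, Finset.mem_range]
      refine ⟨hlt, Nat.lt_succ_of_le (Nat.le_floor (hsN.trans ?_))⟩
      exact Real.rpow_le_rpow (Nat.cast_nonneg _) (by exact_mod_cast hlt.le) hγ''.le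
    have h1 : E N s / R N s ≤ Q := (le_abs_self _).trans
      (Finset.single_le_sum (f := fun p : ℕ × ℕ => |E p.1 p.2 / R p.1 p.2|)
        (fun _ _ => abs_nonneg _) hmem)
    rw [← div_le_iff₀ hRpos]
    linarith

theorem theorem4 {𝕜 : Type*} [RCLike 𝕜] {Ω : ℕ → Type*} [∀ N, MeasurableSpace (Ω N)]
    (P : ∀ N, Measure (Ω N)) [∀ N, IsProbabilityMeasure (P N)]
    (A : ∀ N, Ω N → Matrix (Fin N) (Fin N) 𝕜)
    (μ α : ℝ) (hμ : 0 < μ) (hμ1 : μ ≤ 1) (hα : 2 < α)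
    (a : ℕ → ℝ) (L : ℝ → ℝ)
    (hA : IsSparseHeavyTailed P A μ α a L)
    -- the nonzero entries are symmetrically distributed
    (hsymm : ∀ N (i j : Fin N), (i, j) ∈ nonzeroEntries (P N) (A N) →
      IdentDistrib (fun ω => A N ω i j) (fun ω => -A N ω i j) (P N) (P N))
    -- and have variance one
    (hvar : ∀ N (i j : Fin N), (i, j) ∈ nonzeroEntries (P N) (A N) →
      ∫ ω, ‖A N ω i j - ∫ ω', A N ω' i j ∂(P N)‖ ^ 2 ∂(P N) = 1)
    (γ γ' γ'' : ℝ) (hγ : 0 < γ) (hγ' : 0 < γ') (hγ'' : 0 < γ'')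
    (h1 : μ / 2 ≤ γ') (h2 : μ / 4 + γ + γ'' < γ')
    -- in the boundary case, the row sizes do not exceed `N ^ μ` by too much
    (hbd : γ' = μ / 2 → ∃ C : ℝ, ∀ N : ℕ, (a N - 1) * (N : ℝ) ^ γ'' ≤ C) :
    ∃ L₀ : ℝ → ℝ, SlowlyVarying L₀ ∧
      ∀ N s : ℕ, 1 ≤ s → (s : ℝ) ≤ (N : ℝ) ^ γ'' →
        Integrable
          (fun ω => (truncateEntries ((N : ℝ) ^ γ) (A N ω) ^ (2 * s)).trace) (P N) ∧
        ∫ ω, RCLike.re (truncateEntries ((N : ℝ) ^ γ) (A N ω) ^ (2 * s)).trace ∂(P N) ≤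
          L₀ N * (N : ℝ) ^ (1 + 2 * γ) * (s : ℝ) ^ (-(3 / 2) : ℝ) *
            (2 * (N : ℝ) ^ γ') ^ (2 * s) ∧
        ∀ κ : ℝ, 0 < κ →
          (P N).real {ω | κ * (2 * (N : ℝ) ^ γ') ≤
              l2OpNorm (truncateEntries ((N : ℝ) ^ γ) (A N ω))} ≤
            (κ ^ (2 * s))⁻¹ * (L₀ N * (N : ℝ) ^ (1 + 2 * γ) * (s : ℝ) ^ (-(3 / 2) : ℝ)) := by
  obtain ⟨C₁, hC₁, hev⟩ := eventually_integral_trace_pow_le P A μ α hμ a L hA hsymm hvar γ γ' γ'' hγ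
    h1 h2 hbd
  obtain ⟨C, hC0, hC⟩ := exists_bound_of_eventually hγ''
    (fun N s => ∫ ω, RCLike.re (truncateEntries ((N : ℝ) ^ γ) (A N ω) ^ (2 * s)).trace ∂(P N))
    (fun N s => (N : ℝ) ^ (1 + 2 * γ) * (s : ℝ) ^ (-(3 / 2) : ℝ) * (2 * (N : ℝ) ^ γ') ^ (2 * s))
    (fun N s hN hs => by
      have hN0 : (0 : ℝ) < N := by exact_mod_cast hN
      have hs0 : (0 : ℝ) < s := by exact_mod_cast hs
      positivity) hC₁ hev
  refine ⟨fun _ => C, slowlyVarying_const hC0, fun N s hs hsN => ?_⟩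
  -- The range of `s` is empty at `N = 0`, because `0 ^ γ'' = 0`.
  have hN : 1 ≤ N := by
    rcases Nat.eq_zero_or_pos N with rfl | hN
    · rw [Nat.cast_zero, Real.zero_rpow hγ''.ne'] at hsN
      have : (1 : ℝ) ≤ s := by exact_mod_cast hs
      linarith
    · exact hN
  have hN0 : (0 : ℝ) < N := by exact_mod_cast hN
  have hK : 0 ≤ (N : ℝ) ^ γ := by positivity
  have hE := hC N s hN hs hsN
  refine ⟨integrable_trace_truncateEntries_pow (hA.measurable N) hK (2 * s), ?_, fun κ hκ => ?_⟩
  · calc _ ≤ _ := hE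
      _ = _ := by ring
  · have hx : 0 < 2 * (N : ℝ) ^ γ' := by positivity
    have hM := measure_l2OpNorm_ge_le (P := P N) (hA.measurable N) (hA.hermitian N) hK hs
      (mul_pos hκ hx)
    rw [inv_mul_eq_div, le_div_iff₀ (by positivity)]
    refine le_of_mul_le_mul_right ?_ (pow_pos hx (2 * s))
    calc _ = _ := by rw [mul_assoc, ← mul_pow, mul_comm]
      _ ≤ _ := hM
      _ ≤ _ := hE
      _ = _ := by ring
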